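/- **Model.** Base stations (BSs) form a homogeneous Poisson point process $\Phi=\{x_i\}_i$ of intensity $\lambda>0$ in $\mathbb{R}^2$; the typical user is at the origin $o$. Given $\Phi$, each BS $x_i$ is independently line-of-sight (LOS) with probability $h(\|x_i\|)$, where $h:[0,\infty)\to[0,1]$ is measurable, and non-line-of-sight (NLOS) otherwise. A link of length $r$ has path loss $l_L(r)=\beta r^{\alpha_L}$ if LOS and $l_N(r)=\beta r^{\alpha_N}$ if NLOS ($\beta,\alpha_L,\alpha_N>0$). The fading powers $F_i$ of the links are i.i.d. exponential with mean $1$, independent of the positions and the LOS states. Let $P_b>0$ be the BS transmit power, $\sigma^2\ge 0$ the noise power, $\Gamma_{cs}>0$ the detection threshold, and $M_{cs},N_{cs}\ge 1$ the numbers of beam directions searched by the BSs and by the user. The user main-lobe gain for beamwidth $\theta<2\pi$ is $G(\theta)=\frac{2\pi}{\theta}\frac{\gamma}{\gamma+1}$ with $\gamma=\frac{2\pi}{C_0(2\pi-\theta)}$, $C_0>0$, and $G(2\pi)=1$. Put $K_{cs}=\max(M_{cs},N_{cs})$ and let the $j$-th BS sector, $1\le j\le K_{cs}$, be the set $S_j$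 of points whose polar angle lies in $[\frac{2\pi(j-1)}{K_{cs}},\frac{2\pi j}{K_{cs}})$. The sector $S_j$ is *detected* if the BS $x_0$ of minimum path loss $Z_j$ among the BSs in $S_j$, with fading power $F_0$, satisfies $$\mathrm{SINR}=\frac{F_0/Z_j}{\sum_{i} F_i/l(x_i)+\frac{\sigma^2}{P_bM_{cs}G(2\pi/N_{cs})}}>\Gamma_{cs},$$ where $l(x_i)$ is the path loss of $x_i$ and the sum is over the BSs in $S_j$ with $l(x_i)>Z_j$ (if it diverges, the SINR is $0$). Cell search *succeeds* if at least one sector is detected. **Theorem 1.** The probability that $S_j$ is detected is the same for every $j$ and equals $$P_{M_{cs},N_{cs}}(\Gamma_{cs})=\int_0^\infty \exp\Bigl(-\frac{\Gamma_{cs}z\sigma^2}{P_bM_{cs}G(2\pi/N_{cs})}\Bigr)\,V\Bigl(z,\Gamma_{cs},\frac{\lambda}{K_{cs}}\Bigr)f_{Z_1}(z)\,dz,$$ and the probability $\hat P_{M_{cs},N_{cs}}(\Gamma_{cs})$ that cell search succeeds is $$\hat P_{M_{cs},N_{cs}}(\Gamma_{cs})=1-\bigl(1-P_{M_{cs},N_{cs}}(\Gamma_{cs})\bigr)^{K_{cs}}.$$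 Here, with $l_L^{-1}(z)=(z/\beta)^{1/\alpha_L}$, $l_N^{-1}(z)=(z/\beta)^{1/\alpha_N}$ and $\exp(-\infty)=0$, $$V(z,T,l)=\exp\Bigl\{-2\pi l\Bigl(\int_{l_L^{-1}(z)}^{\infty}\frac{Tz\,h(r)\,r\,dr}{Tz+l_L(r)}+\int_{l_N^{-1}(z)}^{\infty}\frac{Tz\,(1-h(r))\,r\,dr}{Tz+l_N(r)}\Bigr)\Bigr\},$$ $$f_{Z_1}(z)=\frac{2\pi\lambda}{K_{cs}}\Bigl[\tfrac{1}{\alpha_L}\beta^{-2/\alpha_L}z^{2/\alpha_L-1}h(l_L^{-1}(z))+\tfrac{1}{\alpha_N}\beta^{-2/\alpha_N}z^{2/\alpha_N-1}\bigl(1-h(l_N^{-1}(z))\bigr)\Bigr]\exp\Bigl(-\tfrac{2\pi\lambda}{K_{cs}}\Bigl[\int_0^{l_L^{-1}(z)}h(r)\,r\,dr+\int_0^{l_N^{-1}(z)}(1-h(r))\,r\,dr\Bigr]\Bigr).$$ -/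

import Mathlib

open MeasureTheory ProbabilityTheory Set
open scoped ENNReal NNReal

namespace MmWave

noncomputable section

/-! ### Poisson point processes and planar sectors -/

/-- The number of points of the enumerated configuration `x` lying in `B`. -/
def pointCount {Ω E : Type*} (x : ℕ → Ω → E) (B : Set E) (ω : Ω) : ℕ∞ :=
  {i : ℕ | x i ω ∈ B}.encard

/-- The enumerated random points `x 0, x 1, …` form a Poisson point process with intensity
measure `Λ`: counts in sets of finite intensity are Poisson, and counts in pairwise disjoint sets
are independent. -/
structure IsPoissonProcess {Ω E : Type*} [MeasurableSpace Ω] [MeasurableSpace E]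
    (x : ℕ → Ω → E) (Λ : Measure E) (P : Measure Ω) : Prop where
  measurable_points : ∀ i, Measurable (x i)
  law_count : ∀ B : Set E, MeasurableSet B → Λ B ≠ ∞ →
    HasLaw (pointCount x B) ((poissonMeasure (Λ B).toNNReal).map (Nat.cast : ℕ → ℕ∞)) P
  indep_count : ∀ (n : ℕ) (B : Fin n → Set E), (∀ k, MeasurableSet (B k)) →
    Pairwise (fun k l => Disjoint (B k) (B l)) →
    iIndepFun (fun k => pointCount x (B k)) P

/-- The polar angle of a point of the plane (identified with `ℂ`), normalised to `[0, 2π)`. -/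
def polarAngle (x : ℂ) : ℝ := toIcoMod Real.two_pi_pos 0 x.arg

/-- The infinite sector with apex `u` and directions in `[θ₁, θ₂) ⊆ [0, 2π)`. -/
def sector (u : ℂ) (θ₁ θ₂ : ℝ) : Set ℂ := {x | polarAngle (x - u) ∈ Ico θ₁ θ₂}

/-! ### System parameters -/

/-- The deterministic parameters of the cell search model. -/
structure Params where
  /-- intensity of the base stations -/
  lam : ℝ
  /-- probability that a link of a given length is line-of-sight (LOS) -/
  h : ℝ → ℝ
  /-- LOS path loss exponent -/
  alphaL : ℝ
  /-- NLOS path loss exponent -/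
  alphaN : ℝ
  /-- path loss at distance `1` -/
  beta : ℝ
  /-- transmit power of the base stations -/
  Pb : ℝ
  /-- total thermal noise power -/
  sigmaSq : ℝ
  /-- constant of the user antenna pattern -/
  C₀ : ℝ
  /-- number of beam directions searched by the base stations -/
  Mcs : ℕ
  /-- number of beam directions searched by the user -/
  Ncs : ℕ
  /-- SINR detection threshold (linear scale) -/
  Gam : ℝ
  lam_pos : 0 < lam
  h_measurable : Measurable h
  h_mem : ∀ r, 0 ≤ r → h r ∈ Icc (0 : ℝ) 1
  alphaL_pos : 0 < alphaL
  alphaN_pos : 0 < alphaN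
  beta_pos : 0 < beta
  Pb_pos : 0 < Pb
  sigmaSq_nonneg : 0 ≤ sigmaSq
  C₀_pos : 0 < C₀
  Mcs_pos : 0 < Mcs
  Ncs_pos : 0 < Ncs
  Gam_pos : 0 < Gam

namespace Params

variable (p : Params)

/-- The number of base station sectors. -/
def K : ℕ := max p.Mcs p.Ncs

/-- The `j`-th base station sector seen from the typical user at the origin
(`j` is counted from `0`). -/
def bsSector (j : Fin p.K) : Set ℂ :=
  sector 0 (2 * Real.pi * (j : ℝ) / (p.K : ℝ)) (2 * Real.pi * ((j : ℝ) + 1) / (p.K : ℝ))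

/-- LOS path loss (linear scale) at distance `r`. -/
def lossL (r : ℝ) : ℝ := p.beta * r ^ p.alphaL

/-- NLOS path loss (linear scale) at distance `r`. -/
def lossN (r : ℝ) : ℝ := p.beta * r ^ p.alphaN

/-- Inverse of the LOS path loss function. -/
def lossLInv (z : ℝ) : ℝ := (z / p.beta) ^ (1 / p.alphaL)

/-- Inverse of the NLOS path loss function. -/
def lossNInv (z : ℝ) : ℝ := (z / p.beta) ^ (1 / p.alphaN)

/-- Front-back power ratio of the user antenna with beamwidth `θ < 2π`. -/
def frontBackRatio (θ : ℝ) : ℝ := 2 * Real.pi / (p.C₀ * (2 * Real.pi - θ))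

/-- Main lobe gain of the user antenna with beamwidth `θ`. For the omnidirectional antenna
`θ = 2π` the front-back ratio is infinite and the gain is its limit `1`. -/
def userGain (θ : ℝ) : ℝ :=
  if θ = 2 * Real.pi then 1
  else 2 * Real.pi / θ * (p.frontBackRatio θ / (p.frontBackRatio θ + 1))

/-- Noise power normalised by the transmit power, the BS gain `Mcs` and the user gain. -/
def effectiveNoise : ℝ :=
  p.sigmaSq / (p.Pb * (p.Mcs : ℝ) * p.userGain (2 * Real.pi / (p.Ncs : ℝ)))

/-! ### The analytic expression for the detection probability of one sector -/

/-- The sum of the two integrals in the exponent of `V`; it may be infinite. -/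
def interferenceIntegral (z T : ℝ) : ℝ≥0∞ :=
  (∫⁻ r in Ioi (p.lossLInv z), ENNReal.ofReal (T * z * p.h r * r / (T * z + p.lossL r))) +
  (∫⁻ r in Ioi (p.lossNInv z), ENNReal.ofReal (T * z * (1 - p.h r) * r / (T * z + p.lossN r)))

open Classical in
/-- `V(z, T, l) = exp(-2πl · interferenceIntegral z T)`, with `exp(-∞) = 0`. -/
def V (z T l : ℝ) : ℝ :=
  if p.interferenceIntegral z T = ∞ then 0
  else Real.exp (-(2 * Real.pi * l * (p.interferenceIntegral z T).toReal))

/-- The density of the minimum path loss inside one sector, at `z > 0`. -/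
def minLossDensity (z : ℝ) : ℝ :=
  (2 * Real.pi * p.lam / (p.K : ℝ) * (1 / p.alphaL) * (1 / p.beta) ^ (2 / p.alphaL)
      * z ^ (2 / p.alphaL - 1) * p.h (p.lossLInv z)
      * Real.exp (-(2 * Real.pi * p.lam / (p.K : ℝ) * ∫ r in (0 : ℝ)..p.lossLInv z, p.h r * r)))
    * Real.exp (-(2 * Real.pi * p.lam / (p.K : ℝ)
        * ∫ r in (0 : ℝ)..p.lossNInv z, (1 - p.h r) * r))
  + (2 * Real.pi * p.lam / (p.K : ℝ) * (1 / p.alphaN) * (1 / p.beta) ^ (2 / p.alphaN)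
      * z ^ (2 / p.alphaN - 1) * (1 - p.h (p.lossNInv z))
      * Real.exp (-(2 * Real.pi * p.lam / (p.K : ℝ)
        * ∫ r in (0 : ℝ)..p.lossNInv z, (1 - p.h r) * r)))
    * Real.exp (-(2 * Real.pi * p.lam / (p.K : ℝ) * ∫ r in (0 : ℝ)..p.lossLInv z, p.h r * r))

/-- Conditional detection probability of a sector whose minimum path loss is `z`. -/
def condDetectionProb (z : ℝ) : ℝ :=
  Real.exp (-(p.Gam * z * p.effectiveNoise)) * p.V z p.Gam (p.lam / (p.K : ℝ))

/-- The detection probability of one sector, as an integral. -/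
def sectorDetectionProb : ℝ := ∫ z in Ioi (0 : ℝ), p.condDetectionProb z * p.minLossDensity z

end Params

/-! ### The random network -/

/-- The random elements seen by the typical user at the origin: positions of the base stations,
LOS status of the links, and fading powers of the links. -/
structure Network (Ω : Type*) where
  bs : ℕ → Ω → ℂ
  los : ℕ → Ω → Bool
  fading : ℕ → Ω → ℝ

/-- The joint law of the network. The base stations form a homogeneous Poisson process of
intensity `lam`; given all positions, the links are independently LOS with probability
`h (distance)`; the fading powers are i.i.d. exponential with unit mean, independent of
everything else. -/
structure Network.HasModel {Ω : Type*} [MeasurableSpace Ω] (net : Network Ω) (p : Params)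
    (P : Measure Ω) : Prop where
  poisson : IsPoissonProcess net.bs (ENNReal.ofReal p.lam • (volume : Measure ℂ)) P
  measurable_los : ∀ i, Measurable (net.los i)
  measurable_fading : ∀ i, Measurable (net.fading i)
  los_given_bs : ∀ (s : Finset ℕ) (b : ℕ → Bool),
    P⟦{ω | ∀ i ∈ s, net.los i ω = b i} |
        MeasurableSpace.comap (fun ω i => net.bs i ω) inferInstance⟧
      =ᵐ[P] fun ω => ∏ i ∈ s, if b i then p.h ‖net.bs i ω‖ else 1 - p.h ‖net.bs i ω‖
  law_fading : ∀ i, HasLaw (net.fading i) (expMeasure 1) P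
  iIndep_fading : iIndepFun net.fading P
  indep_fading : IndepFun (fun ω i => net.fading i ω)
    (fun ω => ((fun i => net.bs i ω), (fun i => net.los i ω))) P

namespace Network

variable {Ω : Type*} (net : Network Ω) (p : Params)

/-- Path loss of the link between the typical user and base station `i`. -/
def pathLoss (i : ℕ) (ω : Ω) : ℝ :=
  if net.los i ω then p.lossL ‖net.bs i ω‖ else p.lossN ‖net.bs i ω‖

/-- Received power from base station `i`, normalised by the transmit power and antenna gains. -/
def rxPower (i : ℕ) (ω : Ω) : ℝ≥0∞ :=
  ENNReal.ofReal (net.fading i ω) / ENNReal.ofReal (net.pathLoss p i ω)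

/-- Base station `i` provides the minimum path loss among those inside sector `j`. -/
def IsMinPathLoss (j : Fin p.K) (i : ℕ) (ω : Ω) : Prop :=
  net.bs i ω ∈ p.bsSector j ∧
    ∀ k, net.bs k ω ∈ p.bsSector j → net.pathLoss p i ω ≤ net.pathLoss p k ω

/-- The base stations of sector `j` with larger path loss than the serving one `i`. -/
def interferers (j : Fin p.K) (i : ℕ) (ω : Ω) : Set ℕ :=
  {k | net.bs k ω ∈ p.bsSector j ∧ net.pathLoss p i ω < net.pathLoss p k ω}

/-- SINR of the synchronization signal of base station `i` in sector `j`, the beams being aligned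
with that sector. -/
def sinr (j : Fin p.K) (i : ℕ) (ω : Ω) : ℝ≥0∞ :=
  net.rxPower p i ω /
    ((∑' k : net.interferers p j i ω, net.rxPower p k ω) + ENNReal.ofReal p.effectiveNoise)

/-- The event that sector `j` is detected: the SINR of the base station providing the minimum
path loss in that sector exceeds the threshold. -/
def sectorDetected (j : Fin p.K) : Set Ω :=
  {ω | ∃ i, net.IsMinPathLoss p j i ω ∧ ENNReal.ofReal p.Gam < net.sinr p j i ω}

/-- The event that cell search succeeds: at least one sector is detected. -/
def cellSearchSuccess : Set Ω := {ω | ∃ j : Fin p.K, ω ∈ net.sectorDetected p j}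

end Network

end

end MmWave

/-!
# Detection probability of directional cell search

Everything about the network that matters for a sector is the random set of path losses of its
base stations. By the Laplace functional of the Poisson process
(`IsPoissonProcess.integral_expNeg_tsum`), the conditional independence of the LOS states
(`IsPoissonProcess.integral_expNeg_tsum_marked`) and polar coordinates, the path losses of the `K`
sectors are independent Poisson processes on `(0, ∞)` with a common intensity `lossMeasure`, which
has no atoms and is locally finite. This is used in the form of the factorisation of Laplace
functionals, `Network.HasModel.integral_prod_expNeg_sectorSum`.

Given positions and LOS states, the events "sector `j` is detected" depend on disjoint blocks of the
independent fading powers, hence are conditionally independent, and the conditional probability of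
one of them is explicit: with `Z` the minimum path loss, it is
`exp (-Γ Z σ²) ∏ (1 + Γ Z / l)⁻¹`, over the path losses `l > Z` of the sector
(`Network.HasModel.measureReal_freeze_sectorDetected`). The minimum exists and is unique almost
surely, as shown by `Network.HasModel.ae_isRegular`.

To integrate this over `Z`, write `W s = ∏ (1 + Γ s / l)⁻¹` if all path losses `l` exceed `s`, and
`W s = 0` otherwise. The left limit of `W` at `Z` is the product above times `(1 + Γ)⁻¹`, the last
factor being due to the serving base station. Cutting `(0, R]` into cells `(s, s']` of width
`1 / (n + 1)`, the conditional probability is therefore the limit of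
`(1 + Γ) ∑ exp (-Γ s σ²) (W s - W s 1{all l > s'})` (`Network.HasModel.tendsto_approx`). Each
summand is a difference of two Laplace functionals, so products of these sums over several sectors
have factorising means (`Network.HasModel.integral_prod_one_sub_approx`), and the means themselves
are Riemann sums for the integral in the theorem (`tendsto_sum_cells`). Letting `n → ∞` and `R → ∞`
shows that the probability that none of the sectors in a set `s` is detected is
`(1 - sectorDetectionProb) ^ #s` (`Network.HasModel.measureReal_biInter_compl`); the cases of a
single sector and of all sectors are the two assertions.
-/

open Filter Topology

namespace MmWave

/-! ### The negative exponential on the extended half-line -/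

/-- `exp (-x)` for `x ∈ [0, ∞]`, as a real number, with `exp (-∞) = 0`. -/
noncomputable def expNeg (x : ℝ≥0∞) : ℝ := (EReal.exp (-(x : EReal))).toReal

lemma expNeg_of_ne_top {x : ℝ≥0∞} (hx : x ≠ ∞) : expNeg x = Real.exp (-x.toReal) := by
  lift x to ℝ≥0 using hx
  have : (-((x : ℝ≥0∞) : EReal)) = ((-(x : ℝ) : ℝ) : EReal) := by
    rw [EReal.coe_neg]; rfl
  rw [expNeg, this, EReal.exp_coe, ENNReal.toReal_ofReal (Real.exp_nonneg _)]
  simp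

lemma expNeg_ofReal {r : ℝ} (hr : 0 ≤ r) : expNeg (ENNReal.ofReal r) = Real.exp (-r) := by
  rw [expNeg_of_ne_top ENNReal.ofReal_ne_top, ENNReal.toReal_ofReal hr]

@[simp] lemma expNeg_top : expNeg ∞ = 0 := by simp [expNeg]

@[simp] lemma expNeg_zero : expNeg 0 = 1 := by simp [expNeg]

lemma expNeg_nonneg (x : ℝ≥0∞) : 0 ≤ expNeg x := ENNReal.toReal_nonneg

lemma expNeg_le_one (x : ℝ≥0∞) : expNeg x ≤ 1 := by
  by_cases hx : x = ∞
  · simp [hx]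
  · rw [expNeg_of_ne_top hx]; simp

lemma expNeg_add (x y : ℝ≥0∞) : expNeg (x + y) = expNeg x * expNeg y := by
  by_cases hx : x = ∞
  · simp [hx]
  by_cases hy : y = ∞
  · simp [hy]
  rw [expNeg_of_ne_top hx, expNeg_of_ne_top hy, expNeg_of_ne_top (by simp [hx, hy]),
    ENNReal.toReal_add hx hy, ← Real.exp_add]
  congr 1; ring

lemma expNeg_sum {ι : Type*} (s : Finset ι) (f : ι → ℝ≥0∞) :
    expNeg (∑ i ∈ s, f i) = ∏ i ∈ s, expNeg (f i) := by
  classical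
  induction s using Finset.induction_on with
  | empty => simp
  | insert a s ha ih => rw [Finset.sum_insert ha, Finset.prod_insert ha, expNeg_add, ih]

lemma expNeg_natCast_mul (n : ℕ) (a : ℝ≥0∞) : expNeg (a * n) = expNeg a ^ n := by
  have := expNeg_sum (Finset.range n) (fun _ => a)
  simpa [mul_comm] using this

lemma expNeg_anti : Antitone expNeg := by
  intro x y hxy
  obtain ⟨d, rfl⟩ := exists_add_of_le hxy
  rw [expNeg_add]
  exact mul_le_of_le_one_right (expNeg_nonneg _) (expNeg_le_one _)

@[fun_prop] lemma continuous_expNeg : Continuous expNeg := by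
  refine continuous_iff_continuousAt.2 fun x => ?_
  have h1 : Continuous fun x : ℝ≥0∞ => EReal.exp (-(x : EReal)) :=
    ENNReal.continuous_exp.comp (continuous_neg.comp continuous_coe_ennreal_ereal)
  refine (ENNReal.tendsto_toReal ?_).comp h1.continuousAt
  simp

@[fun_prop] lemma measurable_expNeg : Measurable expNeg := continuous_expNeg.measurable

lemma tendsto_integral_expNeg {Ω : Type*} [MeasurableSpace Ω] {P : Measure Ω}
    [IsFiniteMeasure P] {X : ℕ → Ω → ℝ≥0∞} {Y : Ω → ℝ≥0∞} (hX : ∀ n, Measurable (X n))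
    (h : ∀ᵐ ω ∂P, Tendsto (fun n => X n ω) atTop (𝓝 (Y ω))) :
    Tendsto (fun n => ∫ ω, expNeg (X n ω) ∂P) atTop (𝓝 (∫ ω, expNeg (Y ω) ∂P)) := by
  refine tendsto_integral_of_dominated_convergence (fun _ => (1 : ℝ))
    (fun n => (measurable_expNeg.comp (hX n)).aestronglyMeasurable) (integrable_const _)
    (fun n => ae_of_all _ fun ω => ?_) ?_
  · rw [Real.norm_of_nonneg (expNeg_nonneg _)]; exact expNeg_le_one _
  · filter_upwards [h] with ω hω
    exact (continuous_expNeg.tendsto _).comp hω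

lemma integrable_expNeg {Ω : Type*} [MeasurableSpace Ω] {P : Measure Ω}
    [IsFiniteMeasure P] {X : Ω → ℝ≥0∞} (hX : Measurable X) :
    Integrable (fun ω => expNeg (X ω)) P := by
  refine Integrable.of_bound (measurable_expNeg.comp hX).aestronglyMeasurable 1 ?_
  refine ae_of_all _ fun ω => ?_
  rw [Real.norm_of_nonneg (expNeg_nonneg _)]; exact expNeg_le_one _

/-! ### The Laplace functional of a Poisson process -/

lemma toENNReal_pointCount {Ω E : Type*} [MeasurableSpace E] (x : ℕ → Ω → E) (B : Set E) (ω : Ω) :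
    (pointCount x B ω : ℝ≥0∞) = Measure.count {k | x k ω ∈ B} := by
  rw [Measure.count_apply (by measurability)]; rfl

lemma toENNReal_pointCount_eq_tsum {Ω E : Type*} [MeasurableSpace E] (x : ℕ → Ω → E) (B : Set E)
    (ω : Ω) : (pointCount x B ω : ℝ≥0∞) = ∑' k, B.indicator 1 (x k ω) := by
  rw [toENNReal_pointCount, ← lintegral_indicator_one (by measurability), lintegral_count]
  rfl

lemma tsum_simpleFunc_eq_sum_pointCount {Ω E : Type*} [MeasurableSpace E]
    {x : ℕ → Ω → E} (s : SimpleFunc E ℝ≥0∞) (ω : Ω) :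
    ∑' k, s (x k ω) = ∑ a ∈ s.range, a * (pointCount x (s ⁻¹' {a}) ω : ℝ≥0∞) := by
  have hm : Measurable fun k => x k ω := measurable_from_nat
  rw [← lintegral_count (fun k => s (x k ω)), ← lintegral_map s.measurable hm,
    SimpleFunc.lintegral_eq_lintegral, SimpleFunc.lintegral]
  refine Finset.sum_congr rfl fun a _ => ?_
  rw [Measure.map_apply hm (s.measurableSet_preimage _), toENNReal_pointCount]
  rfl

section Laplace

variable {Ω E : Type*} [MeasurableSpace Ω] [MeasurableSpace E] {x : ℕ → Ω → E} {Λ : Measure E}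
  {P : Measure Ω}

lemma IsPoissonProcess.measurable_tsum (hx : IsPoissonProcess x Λ P) {g : E → ℝ≥0∞}
    (hg : Measurable g) : Measurable fun ω => ∑' k, g (x k ω) :=
  Measurable.tsum fun k => hg.comp (hx.measurable_points k)

lemma IsPoissonProcess.integral_expNeg_count_of_ne_top (hx : IsPoissonProcess x Λ P) {B : Set E}
    (hB : MeasurableSet B) (hfin : Λ B ≠ ∞) (a : ℝ≥0∞) :
    ∫ ω, expNeg (a * (pointCount x B ω : ℝ≥0∞)) ∂P
      = expNeg (ENNReal.ofReal (1 - expNeg a) * Λ B) := by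
  have h := (hx.law_count B hB hfin).integral_comp
    (f := fun n : ℕ∞ => expNeg (a * (n : ℝ≥0∞))) Measurable.of_discrete.aestronglyMeasurable
  have h1 : 0 ≤ 1 - expNeg a := sub_nonneg.2 (expNeg_le_one a)
  simp only [Function.comp_def] at h
  rw [h, integral_map_cast_poissonMeasure]
  have h2 : ∀ n : ℕ,
      (Real.exp (-((Λ B).toNNReal : ℝ)) * ((Λ B).toNNReal : ℝ) ^ n / (n.factorial : ℝ)) •
        expNeg (a * (((n : ℕ∞)) : ℝ≥0∞))
      = Real.exp (-((Λ B).toNNReal : ℝ)) *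
        ((((Λ B).toNNReal : ℝ) * expNeg a) ^ n / (n.factorial : ℝ)) := by
    intro n
    rw [ENat.toENNReal_coe, expNeg_natCast_mul, smul_eq_mul, mul_pow]
    ring
  simp_rw [h2]
  rw [tsum_mul_left, ← congrFun NormedSpace.exp_eq_tsum_div, ← Real.exp_eq_exp_ℝ, ← Real.exp_add,
    expNeg_of_ne_top (ENNReal.mul_ne_top ENNReal.ofReal_ne_top hfin), ENNReal.toReal_mul,
    ENNReal.toReal_ofReal h1]
  congr 1
  change -(Λ B).toReal + (Λ B).toReal * _ = _
  ring

lemma IsPoissonProcess.integral_expNeg_count [IsFiniteMeasure P] [SigmaFinite Λ]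
    (hx : IsPoissonProcess x Λ P) {B : Set E} (hB : MeasurableSet B) {a : ℝ≥0∞} (ha : a ≠ ∞) :
    ∫ ω, expNeg (a * (pointCount x B ω : ℝ≥0∞)) ∂P
      = expNeg (ENNReal.ofReal (1 - expNeg a) * Λ B) := by
  have hmono : Monotone fun n => B ∩ spanningSets Λ n := fun m n hmn =>
    inter_subset_inter_right _ (monotone_spanningSets Λ hmn)
  have hU : ⋃ n, B ∩ spanningSets Λ n = B := by
    rw [← inter_iUnion, iUnion_spanningSets, inter_univ]
  have hms : ∀ n, MeasurableSet (B ∩ spanningSets Λ n) := fun n =>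
    hB.inter (measurableSet_spanningSets Λ n)
  have h1 : Tendsto (fun n => ∫ ω, expNeg (a * (pointCount x (B ∩ spanningSets Λ n) ω : ℝ≥0∞)) ∂P)
      atTop (𝓝 (∫ ω, expNeg (a * (pointCount x B ω : ℝ≥0∞)) ∂P)) := by
    refine tendsto_integral_expNeg (fun n => ?_) (ae_of_all _ fun ω => ?_)
    · simp_rw [toENNReal_pointCount_eq_tsum]
      exact (hx.measurable_tsum (measurable_one.indicator (hms n))).const_mul a
    · refine ENNReal.Tendsto.const_mul ?_ (Or.inr ha)
      simp_rw [toENNReal_pointCount]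
      have := tendsto_measure_iUnion_atTop (μ := Measure.count)
        (s := fun n => {k | x k ω ∈ B ∩ spanningSets Λ n}) (fun m n hmn k hk => hmono hmn hk)
      have hU' : ⋃ n, {k | x k ω ∈ B ∩ spanningSets Λ n} = {k | x k ω ∈ B} := by
        ext k
        simp only [mem_iUnion, mem_ofPred_eq]
        rw [← mem_iUnion, hU]
      rwa [hU'] at this
  have h2 : Tendsto (fun n => expNeg (ENNReal.ofReal (1 - expNeg a) * Λ (B ∩ spanningSets Λ n)))
      atTop (𝓝 (expNeg (ENNReal.ofReal (1 - expNeg a) * Λ B))) := by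
    refine (continuous_expNeg.tendsto _).comp ?_
    refine ENNReal.Tendsto.const_mul ?_ (Or.inr ENNReal.ofReal_ne_top)
    have := tendsto_measure_iUnion_atTop (μ := Λ) hmono
    rwa [hU] at this
  refine tendsto_nhds_unique h1 (h2.congr fun n => ?_)
  refine (hx.integral_expNeg_count_of_ne_top (hms n) ?_ a).symm
  exact (measure_mono inter_subset_right |>.trans_lt (measure_spanningSets_lt_top Λ n)).ne

lemma IsPoissonProcess.integral_expNeg_simpleFunc [IsProbabilityMeasure P] [SigmaFinite Λ]
    (hx : IsPoissonProcess x Λ P) (s : SimpleFunc E ℝ≥0∞) (hs : ∀ y, s y ≠ ∞) :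
    ∫ ω, expNeg (∑' k, s (x k ω)) ∂P
      = expNeg (∫⁻ y, ENNReal.ofReal (1 - expNeg (s y)) ∂Λ) := by
  have hR : ∫⁻ y, ENNReal.ofReal (1 - expNeg (s y)) ∂Λ
      = ∑ a ∈ s.range, ENNReal.ofReal (1 - expNeg a) * Λ (s ⁻¹' {a}) := by
    rw [← SimpleFunc.map_lintegral, ← SimpleFunc.lintegral_eq_lintegral]
    rfl
  simp_rw [tsum_simpleFunc_eq_sum_pointCount s]
  rw [hR, expNeg_sum]
  simp_rw [expNeg_sum]
  set n := s.range.card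
  let e : Fin n ≃ s.range := s.range.equivFin.symm
  have hind := hx.indep_count n (fun k => s ⁻¹' {(e k : ℝ≥0∞)})
    (fun k => s.measurableSet_preimage _) (fun k l hkl => by
      refine Disjoint.preimage _ (disjoint_singleton.2 ?_)
      exact fun h => hkl (e.injective (Subtype.ext h)))
  have hmeas : ∀ B : Set E, MeasurableSet B → Measurable (pointCount x B) := by
    intro B hB
    have h1 : Measurable fun ω => (pointCount x B ω : ℝ≥0∞) := by
      simp_rw [toENNReal_pointCount_eq_tsum]
      exact hx.measurable_tsum (measurable_one.indicator hB)
    refine measurable_to_countable' fun c => ?_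
    have : pointCount x B ⁻¹' {c} = (fun ω => (pointCount x B ω : ℝ≥0∞)) ⁻¹' {(c : ℝ≥0∞)} := by
      ext ω; simp
    rw [this]; exact h1 (measurableSet_singleton _)
  have hmul := hind.integral_fun_prod_comp
    (f := fun k (c : ℕ∞) => expNeg ((e k : ℝ≥0∞) * (c : ℝ≥0∞)))
    (fun k => (hmeas _ (s.measurableSet_preimage _)).aemeasurable)
    (fun k => Measurable.of_discrete.aestronglyMeasurable)
  have hprod : ∀ F : ℝ≥0∞ → ℝ, ∏ a ∈ s.range, F a = ∏ k, F (e k : ℝ≥0∞) := by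
    intro F
    rw [← Finset.prod_coe_sort, ← Equiv.prod_comp e]
  calc _ = ∫ ω, ∏ k, expNeg ((e k : ℝ≥0∞) * (pointCount x (s ⁻¹' {(e k : ℝ≥0∞)}) ω : ℝ≥0∞)) ∂P := by
        refine integral_congr_ae (ae_of_all _ fun ω => ?_)
        exact hprod fun a => expNeg (a * (pointCount x (s ⁻¹' {a}) ω : ℝ≥0∞))
    _ = _ := hmul
    _ = _ := by
        rw [hprod fun a => expNeg (ENNReal.ofReal (1 - expNeg a) * Λ (s ⁻¹' {a}))]
        refine Finset.prod_congr rfl fun k _ => ?_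
        refine hx.integral_expNeg_count (s.measurableSet_preimage _) ?_
        obtain ⟨y, hy⟩ := SimpleFunc.mem_range.1 (e k).2
        rw [← hy]; exact hs y

/-- The Laplace functional of a Poisson process. -/
theorem IsPoissonProcess.integral_expNeg_tsum [IsProbabilityMeasure P] [SigmaFinite Λ]
    (hx : IsPoissonProcess x Λ P) {g : E → ℝ≥0∞} (hg : Measurable g) :
    ∫ ω, expNeg (∑' k, g (x k ω)) ∂P
      = expNeg (∫⁻ y, ENNReal.ofReal (1 - expNeg (g y)) ∂Λ) := by
  have hlim : ∀ y, Tendsto (fun n => SimpleFunc.eapprox g n y) atTop (𝓝 (g y)) := fun y =>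
    SimpleFunc.tendsto_eapprox hg y
  have hmono : ∀ y, Monotone fun n => SimpleFunc.eapprox g n y := fun y m n hmn =>
    SimpleFunc.monotone_eapprox g hmn y
  have h1 : Tendsto (fun n => ∫ ω, expNeg (∑' k, SimpleFunc.eapprox g n (x k ω)) ∂P) atTop
      (𝓝 (∫ ω, expNeg (∑' k, g (x k ω)) ∂P)) := by
    refine tendsto_integral_expNeg
      (fun n => hx.measurable_tsum (SimpleFunc.eapprox g n).measurable) (ae_of_all _ fun ω => ?_)
    simp_rw [← lintegral_count]
    exact lintegral_tendsto_of_tendsto_of_monotone (fun n => measurable_from_nat.aemeasurable)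
      (ae_of_all _ fun k => hmono _) (ae_of_all _ fun k => hlim _)
  have h2 : Tendsto (fun n => expNeg (∫⁻ y, ENNReal.ofReal (1 - expNeg (SimpleFunc.eapprox g n y)) ∂Λ))
      atTop (𝓝 (expNeg (∫⁻ y, ENNReal.ofReal (1 - expNeg (g y)) ∂Λ))) := by
    refine (continuous_expNeg.tendsto _).comp ?_
    refine lintegral_tendsto_of_tendsto_of_monotone (fun n => ?_) (ae_of_all _ fun y => ?_)
      (ae_of_all _ fun y => ?_)
    · have := (SimpleFunc.eapprox g n).measurable
      exact Measurable.aemeasurable (by fun_prop)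
    · intro m n hmn
      exact ENNReal.ofReal_le_ofReal (sub_le_sub_left (expNeg_anti (hmono y hmn)) _)
    · exact (ENNReal.continuous_ofReal.tendsto _).comp
        (((continuous_expNeg.tendsto _).comp (hlim y)).const_sub 1)
  refine tendsto_nhds_unique h1 (h2.congr fun n => ?_)
  exact (hx.integral_expNeg_simpleFunc _ fun y => (SimpleFunc.eapprox_lt_top g n y).ne).symm

end Laplace

/-! ### Independent marking -/

open Classical in
/-- The inverse of `expNeg` on `[0, 1]`: it is `-log r`, with value `∞` for `r ≤ 0`. -/
noncomputable def negLog (r : ℝ) : ℝ≥0∞ := if r ≤ 0 then ∞ else ENNReal.ofReal (-Real.log r)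

lemma expNeg_negLog {r : ℝ} (h0 : 0 ≤ r) (h1 : r ≤ 1) : expNeg (negLog r) = r := by
  unfold negLog
  split_ifs with h
  · rw [expNeg_top]; linarith
  · push Not at h
    rw [expNeg_ofReal (by linarith [Real.log_nonpos h0 h1]), neg_neg, Real.exp_log h]

@[fun_prop] lemma measurable_negLog : Measurable negLog := by
  unfold negLog
  exact Measurable.ite measurableSet_Iic measurable_const (by fun_prop)

lemma integral_indicator_mul_eq_integral_condExp_mul {Ω : Type*} {m mΩ : MeasurableSpace Ω}
    {P : Measure Ω} [IsProbabilityMeasure P] (hm : m ≤ mΩ)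
    {A : Set Ω} (hA : MeasurableSet A) {Y : Ω → ℝ} (hY : StronglyMeasurable[m] Y) {C : ℝ}
    (hC : ∀ ω, ‖Y ω‖ ≤ C) :
    ∫ ω, A.indicator (fun _ => (1 : ℝ)) ω * Y ω ∂P = ∫ ω, (P⟦A | m⟧) ω * Y ω ∂P := by
  have hi : Integrable (A.indicator fun _ => (1 : ℝ)) P := (integrable_const 1).indicator hA
  have hY' : AEStronglyMeasurable Y P := (hY.mono hm).aestronglyMeasurable
  have h1 := condExp_mul_of_stronglyMeasurable_right (μ := P) (m := m) hY
    (f := A.indicator fun _ => (1 : ℝ)) (hi.mul_bdd hY' (ae_of_all _ hC)) hi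
  rw [← integral_condExp hm]
  exact integral_congr_ae h1

section Thinning

variable {Ω E : Type*} [mΩ : MeasurableSpace Ω] [MeasurableSpace E] {P : Measure Ω}
  [IsProbabilityMeasure P] {x : ℕ → Ω → E} {t : ℕ → Ω → Bool} {q : E → ℝ}

lemma integral_prod_marked (hx : ∀ i, Measurable (x i)) (ht : ∀ i, Measurable (t i))
    (hcond : ∀ (s : Finset ℕ) (b : ℕ → Bool),
      P⟦{ω | ∀ i ∈ s, t i ω = b i} | MeasurableSpace.comap (fun ω i => x i ω) inferInstance⟧
        =ᵐ[P] fun ω => ∏ i ∈ s, if b i then q (x i ω) else 1 - q (x i ω))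
    {e : E → Bool → ℝ} (he : ∀ b, Measurable fun y => e y b)
    (he0 : ∀ y b, 0 ≤ e y b) (he1 : ∀ y b, e y b ≤ 1) (hq : Measurable q)
    (hq0 : ∀ y, 0 ≤ q y) (hq1 : ∀ y, q y ≤ 1) (s : Finset ℕ) :
    ∫ ω, ∏ i ∈ s, e (x i ω) (t i ω) ∂P
      = ∫ ω, ∏ i ∈ s, (q (x i ω) * e (x i ω) true + (1 - q (x i ω)) * e (x i ω) false) ∂P := by
  classical
  have hm : MeasurableSpace.comap (fun ω i => x i ω) inferInstance ≤ mΩ :=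
    (measurable_pi_lambda _ hx).comap_le
  have hxm : ∀ i, Measurable[MeasurableSpace.comap (fun ω i => x i ω) inferInstance] (x i) := fun i =>
    (measurable_pi_apply i).comp (comap_measurable fun ω i => x i ω)
  -- the indicator of the marks being `true` exactly on `T`, and the corresponding weight
  let A : Finset ℕ → Set Ω := fun T => {ω | ∀ i ∈ s, t i ω = decide (i ∈ T)}
  let Y : Finset ℕ → Ω → ℝ := fun T ω => ∏ i ∈ s, e (x i ω) (decide (i ∈ T))
  have hA : ∀ T, MeasurableSet (A T) := fun T => by
    have : A T = ⋂ i ∈ s, t i ⁻¹' {decide (i ∈ T)} := by ext ω; simp [A]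
    rw [this]
    exact Finset.measurableSet_biInter _ fun i _ => ht i (measurableSet_singleton _)
  have hYm : ∀ T, Measurable[MeasurableSpace.comap (fun ω i => x i ω) inferInstance] (Y T) := fun T =>
    Finset.measurable_fun_prod _ fun i _ => (he _).comp (hxm i)
  have hY0 : ∀ T ω, 0 ≤ Y T ω := fun T ω => Finset.prod_nonneg fun i _ => he0 _ _
  have hY1 : ∀ T ω, ‖Y T ω‖ ≤ 1 := fun T ω => by
    rw [Real.norm_of_nonneg (hY0 T ω)]
    exact Finset.prod_le_one (fun i _ => he0 _ _) fun i _ => he1 _ _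
  let Q : Finset ℕ → Ω → ℝ := fun T ω => ∏ i ∈ s, if decide (i ∈ T) then q (x i ω) else 1 - q (x i ω)
  have hQm : ∀ T, Measurable (Q T) := fun T => by
    refine Finset.measurable_fun_prod _ fun i _ => ?_
    have := hx i
    by_cases h : i ∈ T <;>
      simp only [h, decide_true, decide_false, if_true, Bool.false_eq_true, if_false] <;>
      fun_prop
  have hQ1 : ∀ T ω, ‖Q T ω‖ ≤ 1 := fun T ω => by
    have h : ∀ i, 0 ≤ (if decide (i ∈ T) then q (x i ω) else 1 - q (x i ω)) ∧
        (if decide (i ∈ T) then q (x i ω) else 1 - q (x i ω)) ≤ 1 := fun i => by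
      have := hq0 (x i ω); have := hq1 (x i ω)
      split_ifs <;> constructor <;> linarith
    rw [Real.norm_of_nonneg (Finset.prod_nonneg fun i _ => (h i).1)]
    exact Finset.prod_le_one (fun i _ => (h i).1) fun i _ => (h i).2
  have hL : ∀ ω, ∏ i ∈ s, e (x i ω) (t i ω)
      = ∑ T ∈ s.powerset, (A T).indicator (fun _ => (1 : ℝ)) ω * Y T ω := by
    intro ω
    rw [Finset.sum_eq_single (s.filter fun i => t i ω = true)]
    · have hmem : ω ∈ A (s.filter fun i => t i ω = true) := by
        intro i hi; simp [hi]
      rw [indicator_of_mem hmem, one_mul]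
      exact Finset.prod_congr rfl fun i hi => by simp [hi]
    · intro T hT hne
      rw [indicator_of_notMem, zero_mul]
      intro hmem
      apply hne
      ext i
      rw [Finset.mem_filter]
      constructor
      · intro hi
        exact ⟨Finset.mem_powerset.1 hT hi, by rw [hmem i (Finset.mem_powerset.1 hT hi)]; simpa⟩
      · rintro ⟨hi, h⟩
        rw [hmem i hi] at h; simpa using h
    · intro h; exact absurd (Finset.mem_powerset.2 (Finset.filter_subset _ _)) h
  have hR : ∀ ω, ∏ i ∈ s, (q (x i ω) * e (x i ω) true + (1 - q (x i ω)) * e (x i ω) false)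
      = ∑ T ∈ s.powerset, Q T ω * Y T ω := by
    intro ω
    rw [Finset.prod_add]
    refine Finset.sum_congr rfl fun T hT => ?_
    rw [← Finset.prod_mul_distrib, ← Finset.prod_sdiff (Finset.mem_powerset.1 hT), mul_comm]
    congr 1
    · refine Finset.prod_congr rfl fun i hi => ?_
      simp [(Finset.mem_sdiff.1 hi).2]
    · refine Finset.prod_congr rfl fun i hi => by simp [hi]
  simp_rw [hL, hR]
  have hYs : ∀ T, AEStronglyMeasurable (Y T) P := fun T =>
    ((hYm T).mono hm le_rfl).aestronglyMeasurable
  rw [integral_finsetSum, integral_finsetSum]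
  · refine Finset.sum_congr rfl fun T _ => ?_
    rw [integral_indicator_mul_eq_integral_condExp_mul hm (hA T) (hYm T).stronglyMeasurable (hY1 T)]
    refine integral_congr_ae ?_
    filter_upwards [hcond s fun i => decide (i ∈ T)] with ω hω
    rw [hω]
  · intro T _
    refine Integrable.mul_bdd ?_ (hYs T) (ae_of_all _ (hY1 T))
    exact Integrable.of_bound (hQm T).aestronglyMeasurable 1 (ae_of_all _ (hQ1 T))
  · intro T _
    exact ((integrable_const 1).indicator (hA T)).mul_bdd (hYs T) (ae_of_all _ (hY1 T))

/-- The Laplace functional of a Poisson process with conditionally independent marks `t i`, the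
mark of a point at `y` being `true` with probability `q y`. -/
theorem IsPoissonProcess.integral_expNeg_tsum_marked {Λ : Measure E} [SigmaFinite Λ]
    (hx : IsPoissonProcess x Λ P) (ht : ∀ i, Measurable (t i))
    (hcond : ∀ (s : Finset ℕ) (b : ℕ → Bool),
      P⟦{ω | ∀ i ∈ s, t i ω = b i} | MeasurableSpace.comap (fun ω i => x i ω) inferInstance⟧
        =ᵐ[P] fun ω => ∏ i ∈ s, if b i then q (x i ω) else 1 - q (x i ω))
    (hq : Measurable q) (hq0 : ∀ y, 0 ≤ q y) (hq1 : ∀ y, q y ≤ 1)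
    {g : E → Bool → ℝ≥0∞} (hg : ∀ b, Measurable fun y => g y b) :
    ∫ ω, expNeg (∑' k, g (x k ω) (t k ω)) ∂P
      = expNeg (∫⁻ y, (ENNReal.ofReal (q y) * ENNReal.ofReal (1 - expNeg (g y true))
        + ENNReal.ofReal (1 - q y) * ENNReal.ofReal (1 - expNeg (g y false))) ∂Λ) := by
  have hgt : ∀ k, Measurable fun ω => g (x k ω) (t k ω) := fun k =>
    (measurable_from_prod_countable_left (f := fun z : E × Bool => g z.1 z.2) hg).comp
      ((hx.measurable_points k).prodMk (ht k))
  let r : E → ℝ := fun y => q y * expNeg (g y true) + (1 - q y) * expNeg (g y false)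
  have hr0 : ∀ y, 0 ≤ r y := fun y =>
    add_nonneg (mul_nonneg (hq0 y) (expNeg_nonneg _))
      (mul_nonneg (sub_nonneg.2 (hq1 y)) (expNeg_nonneg _))
  have hr1 : ∀ y, r y ≤ 1 := fun y => by
    have h1 := mul_le_mul_of_nonneg_left (expNeg_le_one (g y true)) (hq0 y)
    have h2 := mul_le_mul_of_nonneg_left (expNeg_le_one (g y false)) (sub_nonneg.2 (hq1 y))
    simp only [r]; linarith
  have hrm : Measurable r := by
    have := hg true; have := hg false
    fun_prop
  have hpart : ∀ {f : ℕ → ℝ≥0∞},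
      Tendsto (fun n => ∑ k ∈ Finset.range n, f k) atTop (𝓝 (∑' k, f k)) :=
    fun {f} => ENNReal.tendsto_nat_tsum f
  have h1 : Tendsto (fun n => ∫ ω, expNeg (∑ k ∈ Finset.range n, g (x k ω) (t k ω)) ∂P) atTop
      (𝓝 (∫ ω, expNeg (∑' k, g (x k ω) (t k ω)) ∂P)) :=
    tendsto_integral_expNeg (fun n => Finset.measurable_fun_sum _ fun k _ => hgt k)
      (ae_of_all _ fun ω => hpart)
  have h2 : Tendsto (fun n => ∫ ω, expNeg (∑ k ∈ Finset.range n, negLog (r (x k ω))) ∂P) atTop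
      (𝓝 (∫ ω, expNeg (∑' k, negLog (r (x k ω))) ∂P)) :=
    tendsto_integral_expNeg (fun n => Finset.measurable_fun_sum _ fun k _ =>
      (measurable_negLog.comp hrm).comp (hx.measurable_points k)) (ae_of_all _ fun ω => hpart)
  have h3 : ∫ ω, expNeg (∑' k, g (x k ω) (t k ω)) ∂P
      = ∫ ω, expNeg (∑' k, negLog (r (x k ω))) ∂P := by
    refine tendsto_nhds_unique h1 (h2.congr fun n => ?_)
    simp_rw [expNeg_sum, expNeg_negLog (hr0 _) (hr1 _)]
    exact (integral_prod_marked (e := fun y b => expNeg (g y b)) hx.measurable_points ht hcond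
      (fun b => measurable_expNeg.comp (hg b)) (fun _ _ => expNeg_nonneg _)
      (fun _ _ => expNeg_le_one _) hq hq0 hq1 _).symm
  rw [h3, hx.integral_expNeg_tsum (g := fun y => negLog (r y)) (measurable_negLog.comp hrm)]
  congr 1
  refine lintegral_congr fun y => ?_
  rw [expNeg_negLog (hr0 y) (hr1 y), ← ENNReal.ofReal_mul (hq0 y),
    ← ENNReal.ofReal_mul (sub_nonneg.2 (hq1 y)), ← ENNReal.ofReal_add]
  · congr 1; simp only [r]; ring
  · exact mul_nonneg (hq0 y) (sub_nonneg.2 (expNeg_le_one _))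
  · exact mul_nonneg (sub_nonneg.2 (hq1 y)) (sub_nonneg.2 (expNeg_le_one _))

end Thinning

/-! ### Polar coordinates and the intensity of the path losses in a sector -/

lemma volume_angles_eq {a b : ℝ} (ha : 0 ≤ a) (hb : b ≤ 2 * Real.pi) :
    volume {θ ∈ Ioo (-Real.pi) Real.pi | toIcoMod Real.two_pi_pos 0 θ ∈ Ico a b}
      = ENNReal.ofReal (b - a) := by
  have hpi := Real.pi_pos
  have h1 : {θ ∈ Ioo (-Real.pi) Real.pi | toIcoMod Real.two_pi_pos 0 θ ∈ Ico a b}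
      = (Ico a b ∩ Iio Real.pi) ∪ ((fun θ => θ + 2 * Real.pi) ⁻¹' (Ico a b ∩ Ioi Real.pi)) := by
    ext θ
    have hpos : 0 ≤ θ → θ < Real.pi → toIcoMod Real.two_pi_pos 0 θ = θ := fun h h' =>
      (toIcoMod_eq_self _).2 ⟨h, by linarith⟩
    have hneg : θ < 0 → -Real.pi < θ → toIcoMod Real.two_pi_pos 0 θ = θ + 2 * Real.pi :=
      fun h h' => by
        rw [← toIcoMod_add_right]
        exact (toIcoMod_eq_self _).2 ⟨by linarith, by linarith⟩
    constructor
    · rintro ⟨hθ, h⟩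
      rcases lt_or_ge θ 0 with h0 | h0
      · rw [hneg h0 hθ.1] at h
        exact Or.inr ⟨h, by simp only [mem_Ioi]; linarith [hθ.1]⟩
      · rw [hpos h0 hθ.2] at h
        exact Or.inl ⟨h, hθ.2⟩
    · rintro (⟨h, h'⟩ | ⟨h, h'⟩)
      · have h0 : 0 ≤ θ := ha.trans h.1
        refine ⟨⟨by linarith, h'⟩, ?_⟩
        rw [hpos h0 h']; exact h
      · simp only [mem_Ioi] at h'
        have h0 : θ < 0 := by linarith [h.2]
        refine ⟨⟨by linarith, by linarith⟩, ?_⟩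
        rw [hneg h0 (by linarith)]; exact h
  rw [h1, measure_union, measure_preimage_add_right]
  · have h2 : volume (Ico a b ∩ Ioi Real.pi) = volume (Ico a b \ Iio Real.pi) := by
      rw [sdiff_eq, compl_Iio]
      exact measure_congr ((ae_eq_refl _).inter Ioi_ae_eq_Ici)
    rw [h2, measure_inter_add_sdiff _ measurableSet_Iio, Real.volume_Ico]
  · rw [Set.disjoint_left]
    rintro θ ⟨h, -⟩ ⟨h', -⟩
    have h3 := h.1
    have h4 : θ + 2 * Real.pi < b := h'.2
    linarith
  · exact measurableSet_preimage (measurable_add_const _) (measurableSet_Ico.inter measurableSet_Ioi)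

lemma measurable_polarAngle : Measurable polarAngle := by
  have : polarAngle = fun x : ℂ =>
      0 + Int.fract ((x.arg - 0) / (2 * Real.pi)) * (2 * Real.pi) := by
    funext x; exact toIcoMod_eq_add_fract_mul _ _ _
  rw [this]
  exact measurable_const.add ((measurable_fract.comp
    ((Complex.measurable_arg.sub_const 0).div_const _)).mul_const _)

lemma measurableSet_sector (u : ℂ) (a b : ℝ) : MeasurableSet (sector u a b) :=
  (measurable_polarAngle.comp (measurable_id.sub_const u)) measurableSet_Ico

lemma lintegral_sector_norm {a b : ℝ} (ha : 0 ≤ a) (hb : b ≤ 2 * Real.pi) {f : ℝ → ℝ≥0∞}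
    (hf : Measurable f) :
    ∫⁻ y in sector 0 a b, f ‖y‖
      = ENNReal.ofReal (b - a) * ∫⁻ r in Ioi (0 : ℝ), ENNReal.ofReal r * f r := by
  rw [← lintegral_indicator (measurableSet_sector 0 a b), ← Complex.lintegral_comp_polarCoord_symm]
  set A : Set ℝ := {θ ∈ Ioo (-Real.pi) Real.pi | toIcoMod Real.two_pi_pos 0 θ ∈ Ico a b} with hA
  have hAm : MeasurableSet A := by
    refine measurableSet_Ioo.inter ?_
    have : Measurable fun θ : ℝ => toIcoMod Real.two_pi_pos 0 θ := by
      have : (fun θ : ℝ => toIcoMod Real.two_pi_pos 0 θ) = fun θ =>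
          0 + Int.fract ((θ - 0) / (2 * Real.pi)) * (2 * Real.pi) := by
        funext x; exact toIcoMod_eq_add_fract_mul _ _ _
      rw [this]
      exact measurable_const.add ((measurable_fract.comp
        ((measurable_id.sub_const 0).div_const _)).mul_const _)
    exact this measurableSet_Ico
  have h1 : ∀ z ∈ polarCoord.target, ENNReal.ofReal z.1 •
      (sector 0 a b).indicator (fun y => f ‖y‖) (Complex.polarCoord.symm z)
      = (ENNReal.ofReal z.1 * f z.1) * A.indicator 1 z.2 := by
    rintro ⟨r, θ⟩ ⟨hr, hθ⟩
    simp only [mem_Ioi] at hr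
    simp only at hθ
    have harg : polarAngle (Complex.polarCoord.symm (r, θ) - 0) = toIcoMod Real.two_pi_pos 0 θ := by
      rw [sub_zero, polarAngle, Complex.polarCoord_symm_apply]
      congr 1
      have := Complex.arg_mul_cos_add_sin_mul_I hr (Ioo_subset_Ioc_self hθ)
      rwa [← Complex.ofReal_cos, ← Complex.ofReal_sin] at this
    have hmem : Complex.polarCoord.symm (r, θ) ∈ sector 0 a b ↔ θ ∈ A := by
      simp only [sector, hA, mem_ofPred_eq, harg, hθ, true_and]
    by_cases h : θ ∈ A
    · rw [indicator_of_mem (hmem.2 h), indicator_of_mem h, Complex.norm_polarCoord_symm,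
        abs_of_pos hr, smul_eq_mul, Pi.one_apply, mul_one]
    · rw [indicator_of_notMem (fun h' => h (hmem.1 h')), indicator_of_notMem h]
      simp
  rw [setLIntegral_congr_fun polarCoord.open_target.measurableSet h1]
  have h2 : polarCoord.target = Ioi (0 : ℝ) ×ˢ Ioo (-Real.pi) Real.pi := rfl
  rw [h2, Measure.volume_eq_prod, ← Measure.prod_restrict,
    lintegral_prod_mul (f := fun r => ENNReal.ofReal r * f r) (by fun_prop)
      (measurable_one.indicator hAm).aemeasurable,
    lintegral_indicator_one hAm, Measure.restrict_apply hAm, mul_comm]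
  congr 1
  rw [← volume_angles_eq ha hb]
  congr 1
  exact inter_eq_left.2 fun θ h => h.1

/-- The substitution `z = β r ^ α` in a planar radial integral. -/
lemma lintegral_radial_comp_rpow {α β : ℝ} (hα : 0 < α) (hβ : 0 < β) (u q : ℝ → ℝ≥0∞) :
    ∫⁻ r in Ioi (0 : ℝ), ENNReal.ofReal r * (u r * q (β * r ^ α))
      = ∫⁻ z in Ioi (0 : ℝ), ENNReal.ofReal (1 / α * (1 / β) ^ (2 / α) * z ^ (2 / α - 1))
          * (u ((z / β) ^ (1 / α)) * q z) := by
  set f : ℝ → ℝ := fun z => (z / β) ^ (1 / α) with hf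
  set f' : ℝ → ℝ := fun z => 1 / β * (1 / α) * (z / β) ^ (1 / α - 1) with hf'
  have hinv : ∀ z ∈ Ioi (0 : ℝ), β * (f z) ^ α = z := by
    intro z hz
    rw [hf]
    simp only
    rw [← Real.rpow_mul (div_pos hz hβ).le, one_div_mul_cancel hα.ne', Real.rpow_one]
    field_simp
  have himg : f '' Ioi 0 = Ioi 0 := by
    ext r
    constructor
    · rintro ⟨z, hz, rfl⟩
      exact Real.rpow_pos_of_pos (div_pos hz hβ) _
    · intro hr
      refine ⟨β * r ^ α, mul_pos hβ (Real.rpow_pos_of_pos hr _), ?_⟩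
      rw [hf]
      simp only
      rw [mul_div_cancel_left₀ _ hβ.ne', ← Real.rpow_mul (le_of_lt hr), mul_one_div_cancel hα.ne',
        Real.rpow_one]
  have hinj : InjOn f (Ioi 0) := fun x hx y hy hxy => by
    rw [← hinv x hx, ← hinv y hy, hxy]
  have hder : ∀ z ∈ Ioi (0 : ℝ), HasDerivWithinAt f (f' z) (Ioi 0) z := by
    intro z hz
    have h1 : HasDerivAt (fun z : ℝ => z / β) (1 / β) z := (hasDerivAt_id z).div_const β
    have h2 := h1.rpow_const (p := 1 / α) (Or.inl (div_pos hz hβ).ne')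
    exact h2.hasDerivWithinAt
  rw [← himg, lintegral_image_eq_lintegral_abs_deriv_mul measurableSet_Ioi hder hinj, himg]
  refine setLIntegral_congr_fun measurableSet_Ioi fun z hz => ?_
  rw [hinv z hz, ← mul_assoc, ← ENNReal.ofReal_mul (abs_nonneg _)]
  congr 2
  have hz' : 0 < z := hz
  have hzb : 0 < z / β := div_pos hz' hβ
  have hpos : 0 < f' z := by simp only [hf']; positivity
  rw [abs_of_pos hpos, hf, hf']
  simp only
  have h3 : 1 / β * (1 / α) * (z / β) ^ (1 / α - 1) * (z / β) ^ (1 / α)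
      = 1 / β * (1 / α) * (z / β) ^ (2 / α - 1) := by
    rw [mul_assoc, ← Real.rpow_add hzb]; congr 2; ring
  rw [h3, div_eq_mul_one_div z β, Real.mul_rpow hz'.le (by positivity),
    Real.rpow_sub_one (x := 1 / β) (by positivity)]
  field_simp

namespace Params

variable (p : Params)

lemma K_pos : 0 < p.K := lt_max_of_lt_left p.Mcs_pos

/-- The hazard rate of the minimum path loss inside one sector: the density, at `z > 0`, of the
intensity of the path losses of the base stations of the sector. -/
noncomputable def lossRate (z : ℝ) : ℝ :=
  2 * Real.pi * p.lam / (p.K : ℝ) * (1 / p.alphaL * (1 / p.beta) ^ (2 / p.alphaL)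
      * z ^ (2 / p.alphaL - 1) * p.h (p.lossLInv z)
    + 1 / p.alphaN * (1 / p.beta) ^ (2 / p.alphaN)
      * z ^ (2 / p.alphaN - 1) * (1 - p.h (p.lossNInv z)))

/-- The intensity measure of the path losses of the base stations of one sector. -/
noncomputable def lossMeasure : Measure ℝ :=
  (volume.restrict (Ioi 0)).withDensity fun z => ENNReal.ofReal (p.lossRate z)

/-- The path loss of a link of length `r`, the Boolean telling whether it is line-of-sight. -/
noncomputable def loss (b : Bool) (r : ℝ) : ℝ := if b then p.lossL r else p.lossN r

lemma lam_div_K_pos : 0 < 2 * Real.pi * p.lam / (p.K : ℝ) := by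
  have := p.K_pos; have := p.lam_pos; have := Real.pi_pos
  positivity

@[fun_prop] lemma measurable_h : Measurable p.h := p.h_measurable

@[fun_prop] lemma measurable_lossL : Measurable p.lossL := by unfold lossL; fun_prop
@[fun_prop] lemma measurable_lossN : Measurable p.lossN := by unfold lossN; fun_prop
@[fun_prop] lemma measurable_lossLInv : Measurable p.lossLInv := by unfold lossLInv; fun_prop
@[fun_prop] lemma measurable_lossNInv : Measurable p.lossNInv := by unfold lossNInv; fun_prop
@[fun_prop] lemma measurable_lossRate : Measurable p.lossRate := by unfold lossRate; fun_prop

lemma lossLInv_nonneg {z : ℝ} (hz : 0 ≤ z) : 0 ≤ p.lossLInv z :=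
  Real.rpow_nonneg (div_nonneg hz p.beta_pos.le) _

lemma lossNInv_nonneg {z : ℝ} (hz : 0 ≤ z) : 0 ≤ p.lossNInv z :=
  Real.rpow_nonneg (div_nonneg hz p.beta_pos.le) _

lemma lossRate_nonneg {z : ℝ} (hz : 0 ≤ z) : 0 ≤ p.lossRate z := by
  have h1 := (p.h_mem _ (p.lossLInv_nonneg hz)).1
  have h2 := sub_nonneg.2 (p.h_mem _ (p.lossNInv_nonneg hz)).2
  have := p.alphaL_pos; have := p.alphaN_pos; have := p.beta_pos; have := p.lam_div_K_pos
  unfold lossRate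
  positivity

/-- Integration against the path loss intensity, in terms of the distances. -/
lemma lintegral_lossMeasure {q : ℝ → ℝ≥0∞} (hq : Measurable q) :
    ∫⁻ z, q z ∂p.lossMeasure = ENNReal.ofReal (2 * Real.pi * p.lam / (p.K : ℝ)) *
      ((∫⁻ r in Ioi (0 : ℝ), ENNReal.ofReal r * (ENNReal.ofReal (p.h r) * q (p.lossL r)))
        + ∫⁻ r in Ioi (0 : ℝ), ENNReal.ofReal r * (ENNReal.ofReal (1 - p.h r) * q (p.lossN r))) := by
  have hL := lintegral_radial_comp_rpow p.alphaL_pos p.beta_pos (fun r => ENNReal.ofReal (p.h r)) q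
  have hN := lintegral_radial_comp_rpow p.alphaN_pos p.beta_pos
    (fun r => ENNReal.ofReal (1 - p.h r)) q
  simp only [← lossL.eq_1, ← lossN.eq_1, ← lossLInv.eq_1, ← lossNInv.eq_1] at hL hN
  rw [hL, hN, ← lintegral_add_left (by fun_prop), ← lintegral_const_mul _ (by fun_prop),
    lossMeasure, lintegral_withDensity_eq_lintegral_mul _ (by fun_prop) hq]
  refine setLIntegral_congr_fun measurableSet_Ioi fun z hz => ?_
  have hz' : 0 < z := hz
  have h1 := (p.h_mem _ (p.lossLInv_nonneg hz'.le)).1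
  have h2 := sub_nonneg.2 (p.h_mem _ (p.lossNInv_nonneg hz'.le)).2
  have := p.alphaL_pos; have := p.alphaN_pos; have := p.beta_pos; have := p.lam_div_K_pos
  simp only [Pi.mul_apply]
  rw [← mul_assoc, ← mul_assoc, ← add_mul, ← mul_assoc, ← ENNReal.ofReal_mul (by positivity),
    ← ENNReal.ofReal_mul (by positivity), ← ENNReal.ofReal_add (by positivity) (by positivity),
    ← ENNReal.ofReal_mul (by positivity)]
  rfl

lemma measurableSet_bsSector (j : Fin p.K) : MeasurableSet (p.bsSector j) :=
  measurableSet_sector _ _ _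

lemma lintegral_bsSector_norm (j : Fin p.K) {f : ℝ → ℝ≥0∞} (hf : Measurable f) :
    ∫⁻ y in p.bsSector j, f ‖y‖
      = ENNReal.ofReal (2 * Real.pi / p.K) * ∫⁻ r in Ioi (0 : ℝ), ENNReal.ofReal r * f r := by
  have hK : (0 : ℝ) < p.K := Nat.cast_pos.2 p.K_pos
  have hpi := Real.pi_pos
  have hj : ((j : ℕ) : ℝ) + 1 ≤ p.K := by exact_mod_cast j.2
  rw [bsSector, lintegral_sector_norm (by positivity) ?_ hf]
  · congr 2; ring
  · rw [div_le_iff₀ hK]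
    exact mul_le_mul_of_nonneg_left hj (by positivity)

lemma disjoint_bsSector {i j : Fin p.K} (hij : i ≠ j) :
    Disjoint (p.bsSector i) (p.bsSector j) := by
  have key : ∀ i j : Fin p.K, i < j → Disjoint (p.bsSector i) (p.bsSector j) := by
    intro i j hij
    rw [Set.disjoint_left]
    intro y hi hj
    have hK : (0 : ℝ) < p.K := Nat.cast_pos.2 p.K_pos
    have hle : ((i : ℕ) : ℝ) + 1 ≤ (j : ℕ) := by exact_mod_cast hij
    have h1 := hi.2
    have h2 := hj.1
    have h3 : 2 * Real.pi * (((i : ℕ) : ℝ) + 1) / (p.K : ℝ) ≤ 2 * Real.pi * (j : ℕ) / (p.K : ℝ) := by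
      have := Real.pi_pos
      gcongr
    exact absurd (h1.trans_le (h3.trans h2)) (lt_irrefl _)
  rcases lt_or_gt_of_ne hij with h | h
  · exact key i j h
  · exact (key j i h).symm

/-- The exponent of the Laplace functional of the base stations, for a function which on sector
`j` is `G j` applied to the path loss and which vanishes outside of the sectors. -/
lemma lintegral_one_sub_expNeg_sectors (G : Fin p.K → ℝ → ℝ≥0∞) (hG : ∀ j, Measurable (G j)) :
    ∫⁻ y : ℂ, (ENNReal.ofReal (p.h ‖y‖) * ENNReal.ofReal (1 - expNeg
          (∑ j, (p.bsSector j).indicator (fun y => G j (p.loss true ‖y‖)) y))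
        + ENNReal.ofReal (1 - p.h ‖y‖) * ENNReal.ofReal (1 - expNeg
          (∑ j, (p.bsSector j).indicator (fun y => G j (p.loss false ‖y‖)) y)))
        ∂(ENNReal.ofReal p.lam • (volume : Measure ℂ))
      = ∑ j, ∫⁻ z, ENNReal.ofReal (1 - expNeg (G j z)) ∂p.lossMeasure := by
  let F : Fin p.K → ℝ → ℝ≥0∞ := fun j r =>
    ENNReal.ofReal (p.h r) * ENNReal.ofReal (1 - expNeg (G j (p.lossL r)))
      + ENNReal.ofReal (1 - p.h r) * ENNReal.ofReal (1 - expNeg (G j (p.lossN r)))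
  have hF : ∀ j, Measurable (F j) := fun j => by
    have := hG j
    fun_prop
  have hpt : ∀ y : ℂ, (ENNReal.ofReal (p.h ‖y‖) * ENNReal.ofReal (1 - expNeg
          (∑ j, (p.bsSector j).indicator (fun y => G j (p.loss true ‖y‖)) y))
        + ENNReal.ofReal (1 - p.h ‖y‖) * ENNReal.ofReal (1 - expNeg
          (∑ j, (p.bsSector j).indicator (fun y => G j (p.loss false ‖y‖)) y)))
      = ∑ j, (p.bsSector j).indicator (fun y => F j ‖y‖) y := by
    intro y
    by_cases hy : ∃ j, y ∈ p.bsSector j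
    · obtain ⟨j, hj⟩ := hy
      have hz : ∀ i, i ≠ j → y ∉ p.bsSector i := fun i hij hi =>
        Set.disjoint_left.1 (p.disjoint_bsSector hij) hi hj
      have hs : ∀ g : Fin p.K → ℂ → ℝ≥0∞, ∑ i, (p.bsSector i).indicator (g i) y = g j y :=
        fun g => by
          rw [Finset.sum_eq_single j (fun i _ hij => indicator_of_notMem (hz i hij) _)
            (fun h => absurd (Finset.mem_univ j) h), indicator_of_mem hj]
      rw [hs, hs, hs]
      rfl
    · push Not at hy
      have hs : ∀ g : Fin p.K → ℂ → ℝ≥0∞, ∑ i, (p.bsSector i).indicator (g i) y = 0 :=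
        fun g => Finset.sum_eq_zero fun i _ => indicator_of_notMem (hy i) _
      rw [hs, hs, hs]
      simp
  simp_rw [hpt]
  have hFm : ∀ j, Measurable ((p.bsSector j).indicator fun y => F j ‖y‖) := fun j =>
    ((hF j).comp measurable_norm).indicator (p.measurableSet_bsSector j)
  rw [lintegral_smul_measure, lintegral_finsetSum _ (fun j _ => hFm j), smul_eq_mul,
    Finset.mul_sum]
  refine Finset.sum_congr rfl fun j _ => ?_
  have := hG j
  rw [lintegral_indicator (p.measurableSet_bsSector j), p.lintegral_bsSector_norm j (hF j),
    p.lintegral_lossMeasure (by fun_prop), ← mul_assoc, ← ENNReal.ofReal_mul p.lam_pos.le,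
    ← lintegral_add_left (by fun_prop)]
  congr 1
  · congr 1; ring
  · refine lintegral_congr fun r => ?_
    rw [← mul_add]

end Params

lemma mul_rpow_le_iff {α β r z : ℝ} (hα : 0 < α) (hβ : 0 < β) (hr : 0 ≤ r) (hz : 0 ≤ z) :
    β * r ^ α ≤ z ↔ r ≤ (z / β) ^ (1 / α) := by
  rw [one_div, Real.le_rpow_inv_iff_of_pos hr (div_nonneg hz hβ.le) hα, le_div_iff₀ hβ, mul_comm]

/-- A radial integral over the distances whose path loss lies in `S`. -/
lemma lintegral_radial_indicator {S T : Set ℝ} (hT : MeasurableSet T) (hT0 : T ⊆ Ioi 0)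
    {l : ℝ → ℝ} (hiff : ∀ r, 0 < r → (l r ∈ S ↔ r ∈ T)) {u f g : ℝ → ℝ≥0∞}
    (hfg : ∀ r ∈ T, ENNReal.ofReal r * (u r * f (l r)) = g r) :
    ∫⁻ r in Ioi (0 : ℝ), ENNReal.ofReal r * (u r * S.indicator f (l r)) = ∫⁻ r in T, g r := by
  rw [← inter_eq_left.2 hT0, ← Measure.restrict_restrict hT, ← lintegral_indicator hT]
  refine setLIntegral_congr_fun measurableSet_Ioi fun r hr => ?_
  by_cases h : r ∈ T
  · simp only [indicator_of_mem h, indicator_of_mem ((hiff r hr).2 h), hfg r h]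
  · simp [indicator_of_notMem h, indicator_of_notMem (mt (hiff r hr).1 h)]

namespace Params

variable (p : Params)

lemma lossL_le_iff {r z : ℝ} (hr : 0 ≤ r) (hz : 0 ≤ z) : p.lossL r ≤ z ↔ r ≤ p.lossLInv z :=
  mul_rpow_le_iff p.alphaL_pos p.beta_pos hr hz

lemma lossN_le_iff {r z : ℝ} (hr : 0 ≤ r) (hz : 0 ≤ z) : p.lossN r ≤ z ↔ r ≤ p.lossNInv z :=
  mul_rpow_le_iff p.alphaN_pos p.beta_pos hr hz

lemma lossL_pos {r : ℝ} (hr : 0 < r) : 0 < p.lossL r :=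
  mul_pos p.beta_pos (Real.rpow_pos_of_pos hr _)

lemma lossN_pos {r : ℝ} (hr : 0 < r) : 0 < p.lossN r :=
  mul_pos p.beta_pos (Real.rpow_pos_of_pos hr _)

lemma lossMeasure_Iic_zero : p.lossMeasure (Iic 0) = 0 := by
  rw [lossMeasure, withDensity_apply _ measurableSet_Iic, Measure.restrict_restrict measurableSet_Iic,
    Iic_inter_Ioi, Ioc_self, Measure.restrict_empty, lintegral_zero_measure]

lemma lossMeasure_absolutelyContinuous : p.lossMeasure ≪ volume :=
  (withDensity_absolutelyContinuous _ _).trans Measure.absolutelyContinuous_restrict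

instance : NullSingletonClass p.lossMeasure := ⟨fun _ => p.lossMeasure_absolutelyContinuous (by simp)⟩

/-- Integral of a bounded radial weight up to a given distance, in extended and in real form. -/
lemma lintegral_Ioc_eq_ofReal_intervalIntegral {u : ℝ → ℝ} (hu : Measurable u)
    (h0 : ∀ r, 0 ≤ r → u r ∈ Icc (0 : ℝ) 1) {a : ℝ} (ha : 0 ≤ a) :
    ∫⁻ r in Ioc 0 a, ENNReal.ofReal (u r * r) = ENNReal.ofReal (∫ r in (0 : ℝ)..a, u r * r) := by
  rw [intervalIntegral.integral_of_le ha, ofReal_integral_eq_lintegral_ofReal]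
  · refine Measure.integrableOn_of_bounded (M := a) (by simp) (by fun_prop) ?_
    refine (ae_restrict_iff' measurableSet_Ioc).2 (ae_of_all _ fun r hr => ?_)
    have h := h0 r hr.1.le
    rw [Real.norm_of_nonneg (mul_nonneg h.1 hr.1.le)]
    nlinarith [h.1, h.2, hr.1, hr.2]
  · refine (ae_restrict_iff' measurableSet_Ioc).2 (ae_of_all _ fun r hr => ?_)
    exact mul_nonneg (h0 r hr.1.le).1 hr.1.le

lemma one_sub_h_mem {r : ℝ} (hr : 0 ≤ r) : 1 - p.h r ∈ Icc (0 : ℝ) 1 := by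
  have := p.h_mem r hr
  exact ⟨by linarith [this.2], by linarith [this.1]⟩

lemma lossMeasure_Ioc {z : ℝ} (hz : 0 ≤ z) :
    p.lossMeasure (Ioc 0 z) = ENNReal.ofReal (2 * Real.pi * p.lam / (p.K : ℝ)) *
      (ENNReal.ofReal (∫ r in (0 : ℝ)..p.lossLInv z, p.h r * r)
        + ENNReal.ofReal (∫ r in (0 : ℝ)..p.lossNInv z, (1 - p.h r) * r)) := by
  rw [← lintegral_indicator_one measurableSet_Ioc,
    p.lintegral_lossMeasure (measurable_one.indicator measurableSet_Ioc),
    ← lintegral_Ioc_eq_ofReal_intervalIntegral p.h_measurable p.h_mem (p.lossLInv_nonneg hz),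
    ← lintegral_Ioc_eq_ofReal_intervalIntegral (by fun_prop) (fun r => p.one_sub_h_mem)
      (p.lossNInv_nonneg hz)]
  congr 2
  · refine lintegral_radial_indicator measurableSet_Ioc (fun r hr => hr.1)
      (fun r hr => by simp [p.lossL_pos hr, p.lossL_le_iff hr.le hz, hr]) fun r hr => ?_
    rw [Pi.one_apply, mul_one, ← ENNReal.ofReal_mul hr.1.le, mul_comm]
  · refine lintegral_radial_indicator measurableSet_Ioc (fun r hr => hr.1)
      (fun r hr => by simp [p.lossN_pos hr, p.lossN_le_iff hr.le hz, hr]) fun r hr => ?_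
    rw [Pi.one_apply, mul_one, ← ENNReal.ofReal_mul hr.1.le, mul_comm]

lemma lossMeasure_Iic_lt_top (z : ℝ) : p.lossMeasure (Iic z) < ∞ := by
  rcases le_or_gt 0 z with hz | hz
  · have h1 : p.lossMeasure (Ioc 0 z) < ∞ := by
      rw [p.lossMeasure_Ioc hz]
      finiteness
    rw [← Iic_union_Ioc_eq_Iic hz]
    exact (measure_union_le _ _).trans_lt (by rw [p.lossMeasure_Iic_zero, zero_add]; exact h1)
  · exact (measure_mono (Iic_subset_Iic.2 hz.le)).trans_lt (by simp [p.lossMeasure_Iic_zero])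

instance : IsLocallyFiniteMeasure p.lossMeasure :=
  ⟨fun z => ⟨Iic (z + 1), Iic_mem_nhds (by linarith), p.lossMeasure_Iic_lt_top _⟩⟩

/-- The Laplace exponent of the interference from base stations of path loss larger than `z`. -/
lemma lintegral_Ioi_lossMeasure {z T : ℝ} (hz : 0 < z) :
    ∫⁻ l in Ioi z, ENNReal.ofReal (T * z / (T * z + l)) ∂p.lossMeasure
      = ENNReal.ofReal (2 * Real.pi * p.lam / (p.K : ℝ)) * p.interferenceIntegral z T := by
  rw [← lintegral_indicator measurableSet_Ioi, p.lintegral_lossMeasure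
    (Measurable.indicator (by fun_prop) measurableSet_Ioi), interferenceIntegral]
  congr 2
  · have hinv := p.lossLInv_nonneg hz.le
    refine lintegral_radial_indicator measurableSet_Ioi (fun r hr => hinv.trans_lt hr)
      (fun r hr => by simp only [mem_Ioi, ← not_le, p.lossL_le_iff hr.le hz.le]) fun r hr => ?_
    have hr' : 0 ≤ r := (hinv.trans_lt hr).le
    rw [← ENNReal.ofReal_mul (p.h_mem r hr').1, ← ENNReal.ofReal_mul hr']
    congr 1; ring
  · have hinv := p.lossNInv_nonneg hz.le
    refine lintegral_radial_indicator measurableSet_Ioi (fun r hr => hinv.trans_lt hr)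
      (fun r hr => by simp only [mem_Ioi, ← not_le, p.lossN_le_iff hr.le hz.le]) fun r hr => ?_
    have hr' : 0 ≤ r := (hinv.trans_lt hr).le
    rw [← ENNReal.ofReal_mul (p.one_sub_h_mem hr').1, ← ENNReal.ofReal_mul hr']
    congr 1; ring

lemma V_eq_expNeg {z T : ℝ} (hz : 0 < z) :
    p.V z T (p.lam / (p.K : ℝ))
      = expNeg (∫⁻ l in Ioi z, ENNReal.ofReal (T * z / (T * z + l)) ∂p.lossMeasure) := by
  have hc := p.lam_div_K_pos
  rw [p.lintegral_Ioi_lossMeasure hz, V]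
  split_ifs with h
  · rw [h, ENNReal.mul_top (by simpa using hc), expNeg_top]
  · rw [expNeg_of_ne_top (by finiteness), ENNReal.toReal_mul, ENNReal.toReal_ofReal hc.le]
    congr 2; ring

lemma minLossDensity_eq {z : ℝ} (hz : 0 ≤ z) :
    p.minLossDensity z = p.lossRate z * expNeg (p.lossMeasure (Iic z)) := by
  have hc := p.lam_div_K_pos
  have hL : 0 ≤ ∫ r in (0 : ℝ)..p.lossLInv z, p.h r * r :=
    intervalIntegral.integral_nonneg (p.lossLInv_nonneg hz) fun r hr =>
      mul_nonneg (p.h_mem r hr.1).1 hr.1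
  have hN : 0 ≤ ∫ r in (0 : ℝ)..p.lossNInv z, (1 - p.h r) * r :=
    intervalIntegral.integral_nonneg (p.lossNInv_nonneg hz) fun r hr =>
      mul_nonneg (p.one_sub_h_mem hr.1).1 hr.1
  have h1 : p.lossMeasure (Iic z) = p.lossMeasure (Ioc 0 z) := by
    rw [← Iic_union_Ioc_eq_Iic hz]
    exact measure_congr (union_ae_eq_right_of_ae_eq_empty (ae_eq_empty.2 p.lossMeasure_Iic_zero))
  rw [h1, p.lossMeasure_Ioc hz, ← ENNReal.ofReal_add hL hN, ← ENNReal.ofReal_mul hc.le,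
    expNeg_ofReal (by positivity), mul_add, neg_add, Real.exp_add, minLossDensity, lossRate]
  ring

end Params

/-! ### Laplace functionals of the path losses in the sectors -/

namespace Network

variable {Ω : Type*} (net : Network Ω) (p : Params)

/-- The sum of `G` over the path losses of the base stations in sector `j`. -/
noncomputable def sectorSum (j : Fin p.K) (G : ℝ → ℝ≥0∞) (ω : Ω) : ℝ≥0∞ :=
  ∑' k, (p.bsSector j).indicator (fun _ => G (net.pathLoss p k ω)) (net.bs k ω)

variable [MeasurableSpace Ω] {net}

lemma measurable_pathLoss (hb : ∀ i, Measurable (net.bs i)) (hl : ∀ i, Measurable (net.los i))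
    (k : ℕ) : Measurable (net.pathLoss p k) := by
  have := hb k
  exact Measurable.ite (hl k (measurableSet_singleton true)) (by fun_prop) (by fun_prop)

lemma measurable_sectorSum (hb : ∀ i, Measurable (net.bs i)) (hl : ∀ i, Measurable (net.los i))
    (j : Fin p.K) {G : ℝ → ℝ≥0∞} (hG : Measurable G) : Measurable (net.sectorSum p j G) := by
  refine Measurable.tsum fun k => ?_
  have h := (hG.comp (measurable_pathLoss p hb hl k)).indicator (hb k (p.measurableSet_bsSector j))
  exact h

variable {p} {P : Measure Ω} [IsProbabilityMeasure P]

/-- The path loss processes of the sectors are independent Poisson processes with intensity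
`lossMeasure`, expressed by Laplace functionals. -/
theorem HasModel.integral_prod_expNeg_sectorSum (hnet : net.HasModel p P)
    (G : Fin p.K → ℝ → ℝ≥0∞) (hG : ∀ j, Measurable (G j)) :
    ∫ ω, ∏ j, expNeg (net.sectorSum p j (G j) ω) ∂P
      = ∏ j, expNeg (∫⁻ z, ENNReal.ofReal (1 - expNeg (G j z)) ∂p.lossMeasure) := by
  have hq : Measurable fun y : ℂ => p.h ‖y‖ := by fun_prop
  have hloss : ∀ b, Measurable (p.loss b) := by
    rintro (_ | _)
    · exact p.measurable_lossN
    · exact p.measurable_lossL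
  have : SigmaFinite (ENNReal.ofReal p.lam • (volume : Measure ℂ)) :=
    inferInstanceAs (SigmaFinite (p.lam.toNNReal • (volume : Measure ℂ)))
  have h := hnet.poisson.integral_expNeg_tsum_marked hnet.measurable_los hnet.los_given_bs hq
    (fun y => (p.h_mem _ (norm_nonneg y)).1) (fun y => (p.h_mem _ (norm_nonneg y)).2)
    (g := fun y b => ∑ j, (p.bsSector j).indicator (fun y => G j (p.loss b ‖y‖)) y)
    (fun b => Finset.measurable_fun_sum _ fun j _ =>
      ((hG j).comp ((hloss b).comp measurable_norm)).indicator (p.measurableSet_bsSector j))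
  rw [p.lintegral_one_sub_expNeg_sectors G hG, expNeg_sum] at h
  rw [← h]
  refine integral_congr_ae (ae_of_all _ fun ω => ?_)
  simp only
  rw [← expNeg_sum, Summable.tsum_finsetSum (fun _ _ => ENNReal.summable)]
  rfl

lemma HasModel.integral_expNeg_sectorSum (hnet : net.HasModel p P) (j : Fin p.K)
    {G : ℝ → ℝ≥0∞} (hG : Measurable G) :
    ∫ ω, expNeg (net.sectorSum p j G ω) ∂P
      = expNeg (∫⁻ z, ENNReal.ofReal (1 - expNeg (G z)) ∂p.lossMeasure) := by
  classical
  have h := hnet.integral_prod_expNeg_sectorSum (Function.update (fun _ _ => 0) j G) (fun i => by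
    by_cases hi : i = j
    · subst hi; simpa using hG
    · simp only [Function.update_of_ne hi]; exact measurable_const)
  have h0 : ∀ i ω, net.sectorSum p i (fun _ => 0) ω = 0 := fun i ω => by simp [sectorSum]
  rw [Finset.prod_eq_single j (fun i _ hi => by simp [Function.update_of_ne hi])
    (fun hj => absurd (Finset.mem_univ j) hj)] at h
  simp only [Function.update_self] at h
  rw [← h]
  refine integral_congr_ae (ae_of_all _ fun ω => ?_)
  simp only
  rw [Finset.prod_eq_single j (fun i _ hi => by simp [Function.update_of_ne hi, h0])
    (fun hj => absurd (Finset.mem_univ j) hj), Function.update_self]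

end Network

/-! ### Riemann sums over cells of width `1 / (n + 1)` -/

/-- The `m`-th cell of the partition of `(0, ∞)` into intervals of length `1 / (n + 1)`. -/
def cell (n m : ℕ) : Set ℝ := Ioc ((m : ℝ) / (n + 1)) (((m : ℝ) + 1) / (n + 1))

/-- The index of the cell containing `z > 0`. -/
noncomputable def cellIndex (n : ℕ) (z : ℝ) : ℕ := ⌈z * (n + 1)⌉₊ - 1

/-- The left end of the cell containing `z > 0`. -/
noncomputable def cellLeft (n : ℕ) (z : ℝ) : ℝ := (cellIndex n z : ℝ) / (n + 1)

lemma measurableSet_cell (n m : ℕ) : MeasurableSet (cell n m) := measurableSet_Ioc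

@[fun_prop] lemma measurable_cellIndex (n : ℕ) : Measurable (cellIndex n) := by
  unfold cellIndex
  exact (Measurable.of_discrete (f := fun k : ℕ => k - 1)).comp (by fun_prop)

lemma measurable_cellIndex_comp (n : ℕ) {f : ℕ → ℝ → ℝ≥0∞} (hf : ∀ m, Measurable (f m)) :
    Measurable fun z => f (cellIndex n z) z :=
  (measurable_from_prod_countable_right (f := fun v : ℕ × ℝ => f v.1 v.2) hf).comp
    ((measurable_cellIndex n).prodMk measurable_id)

lemma mem_cell_iff {n m : ℕ} {z : ℝ} (hz : 0 < z) : z ∈ cell n m ↔ cellIndex n z = m := by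
  have hn : (0 : ℝ) < n + 1 := by positivity
  have hc : 0 < ⌈z * (n + 1)⌉₊ := Nat.ceil_pos.2 (by positivity)
  have h1 : cellIndex n z = m ↔ ⌈z * (n + 1)⌉₊ = m + 1 := by unfold cellIndex; omega
  rw [h1, Nat.ceil_eq_iff (by omega), cell, mem_Ioc, div_lt_iff₀ hn, le_div_iff₀ hn]
  simp

lemma cell_subset_Ioi (n m : ℕ) : cell n m ⊆ Ioi 0 := fun z hz =>
  lt_of_le_of_lt (by positivity) hz.1

lemma mem_cell_cellIndex {z : ℝ} (hz : 0 < z) (n : ℕ) : z ∈ cell n (cellIndex n z) :=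
  (mem_cell_iff hz).2 rfl

lemma cellLeft_nonneg (n : ℕ) (z : ℝ) : 0 ≤ cellLeft n z := by unfold cellLeft; positivity

lemma cellLeft_lt {z : ℝ} (hz : 0 < z) (n : ℕ) : cellLeft n z < z := (mem_cell_cellIndex hz n).1

lemma tendsto_one_div_add_one : Tendsto (fun n : ℕ => 1 / ((n : ℝ) + 1)) atTop (𝓝 0) :=
  tendsto_one_div_add_atTop_nhds_zero_nat

lemma tendsto_cellLeft {z : ℝ} (hz : 0 < z) : Tendsto (fun n => cellLeft n z) atTop (𝓝 z) := by
  have h : Tendsto (fun n : ℕ => z - 1 / ((n : ℝ) + 1)) atTop (𝓝 z) := by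
    simpa using tendsto_one_div_add_one.const_sub z
  refine tendsto_of_tendsto_of_tendsto_of_le_of_le h tendsto_const_nhds (fun n => ?_)
    (fun n => (cellLeft_lt hz n).le)
  have := (mem_cell_cellIndex hz n).2
  rw [add_div] at this
  simp only [cellLeft]; linarith

lemma sum_lintegral_cell (μ : Measure ℝ) (n M : ℕ) (f : ℕ → ℝ → ℝ≥0∞) :
    ∑ m ∈ Finset.range M, ∫⁻ z in cell n m, f m z ∂μ
      = ∫⁻ z in Ioc 0 ((M : ℝ) / (n + 1)), f (cellIndex n z) z ∂μ := by
  induction M with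
  | zero => simp
  | succ M ih =>
    have h1 : Ioc 0 (((M + 1 : ℕ) : ℝ) / (n + 1)) = Ioc 0 ((M : ℝ) / (n + 1)) ∪ cell n M := by
      rw [cell, Ioc_union_Ioc_eq_Ioc (by positivity) (by gcongr; linarith)]
      push_cast; rfl
    have h2 : Disjoint (Ioc 0 ((M : ℝ) / (n + 1))) (cell n M) := by
      rw [Set.disjoint_left]
      exact fun z h h' => absurd h'.1 (not_lt.2 h.2)
    rw [Finset.sum_range_succ, ih, h1, lintegral_union (measurableSet_cell _ _) h2]
    congr 1
    refine setLIntegral_congr_fun (measurableSet_cell _ _) fun z hz => ?_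
    simp only [(mem_cell_iff (cell_subset_Ioi _ _ hz)).1 hz]

lemma sum_lintegral_cell_nat (μ : Measure ℝ) (n R : ℕ) (f : ℕ → ℝ → ℝ≥0∞) :
    ∑ m ∈ Finset.range (R * (n + 1)), ∫⁻ z in cell n m, f m z ∂μ
      = ∫⁻ z in Ioc 0 (R : ℝ), f (cellIndex n z) z ∂μ := by
  rw [sum_lintegral_cell]
  have : (((R * (n + 1) : ℕ) : ℝ)) / (n + 1) = R := by push_cast; field_simp
  rw [this]

section Limit

variable {μ : Measure ℝ} [NullSingletonClass μ]

lemma measure_cell_lt_top (μ : Measure ℝ) [IsLocallyFiniteMeasure μ] (n m : ℕ) :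
    μ (cell n m) < ∞ := measure_Ioc_lt_top

lemma tendsto_measure_cell [IsLocallyFiniteMeasure μ] {z : ℝ} (hz : 0 < z) :
    Tendsto (fun n => μ (cell n (cellIndex n z))) atTop (𝓝 0) := by
  refine tendsto_of_tendsto_of_tendsto_of_le_of_le tendsto_const_nhds
    ((tendsto_measure_Icc μ z).comp tendsto_one_div_add_one) (fun n => bot_le) fun n => ?_
  refine measure_mono fun y hy => ?_
  have h := mem_cell_cellIndex hz n
  rw [cell, add_div] at h hy
  constructor <;> linarith [h.1, h.2, hy.1, hy.2]

/-- The squared masses of small cells are negligible, for a measure without atoms. -/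
lemma tendsto_sum_measure_cell_sq [IsLocallyFiniteMeasure μ] (R : ℕ) :
    Tendsto (fun n => ∑ m ∈ Finset.range (R * (n + 1)), μ (cell n m) * μ (cell n m)) atTop
      (𝓝 0) := by
  have h1 : ∀ n, ∑ m ∈ Finset.range (R * (n + 1)), μ (cell n m) * μ (cell n m)
      = ∫⁻ z in Ioc 0 (R : ℝ), μ (cell n (cellIndex n z)) ∂μ := fun n => by
    rw [← sum_lintegral_cell_nat μ n R fun m _ => μ (cell n m)]
    exact Finset.sum_congr rfl fun m _ => by rw [setLIntegral_const]
  simp_rw [h1]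
  have h0 : ∫⁻ _ in Ioc 0 (R : ℝ), (0 : ℝ≥0∞) ∂μ = 0 := by simp
  rw [← h0]
  have hbd : ∀ n, ∀ z ∈ Ioc 0 (R : ℝ), cell n (cellIndex n z) ⊆ Ioc 0 ((R : ℝ) + 1) := by
    intro n z hz y hy
    refine ⟨cell_subset_Ioi _ _ hy, ?_⟩
    have h := mem_cell_cellIndex hz.1 n
    have h2 : 1 / ((n : ℝ) + 1) ≤ 1 := by
      rw [div_le_one (by positivity)]; linarith [Nat.cast_nonneg (α := ℝ) n]
    rw [cell, add_div] at h hy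
    linarith [h.1, hy.2, hz.2]
  refine tendsto_lintegral_of_dominated_convergence (fun _ => μ (Ioc 0 ((R : ℝ) + 1)))
    (fun n => ?_) (fun n => ?_) ?_ ?_
  · exact (Measurable.of_discrete (f := fun m : ℕ => μ (cell n m))).comp (measurable_cellIndex n)
  · exact (ae_restrict_iff' measurableSet_Ioc).2 (ae_of_all _ fun z hz => measure_mono (hbd n z hz))
  · rw [setLIntegral_const]
    exact ENNReal.mul_ne_top measure_Ioc_lt_top.ne measure_Ioc_lt_top.ne
  · exact (ae_restrict_iff' measurableSet_Ioc).2 (ae_of_all _ fun z hz => tendsto_measure_cell hz.1)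

/-- The exponent such that `expNeg (∑ kern T s l)` over a configuration of path losses `l` vanishes
if there is a path loss at most `s`, and is otherwise the Laplace transform at `T * s` of the
interference of Rayleigh faded links. -/
noncomputable def kern (T s l : ℝ) : ℝ≥0∞ :=
  if l ≤ s then ∞ else ENNReal.ofReal (Real.log (1 + T * s / l))

lemma kern_of_le {T s l : ℝ} (h : l ≤ s) : kern T s l = ∞ := if_pos h

lemma kern_of_lt {T s l : ℝ} (h : s < l) :
    kern T s l = ENNReal.ofReal (Real.log (1 + T * s / l)) := if_neg (not_le.2 h)

lemma expNeg_kern_of_lt {T s l : ℝ} (hT : 0 < T) (hs : 0 ≤ s) (h : s < l) :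
    expNeg (kern T s l) = l / (T * s + l) := by
  have hl : 0 < l := hs.trans_lt h
  have h1 : 0 ≤ T * s / l := by positivity
  rw [kern_of_lt h, expNeg_ofReal (Real.log_nonneg (by linarith)), Real.exp_neg,
    Real.exp_log (by linarith)]
  field_simp
  ring

lemma one_sub_expNeg_kern_of_lt {T s l : ℝ} (hT : 0 < T) (hs : 0 ≤ s) (h : s < l) :
    1 - expNeg (kern T s l) = T * s / (T * s + l) := by
  have hl : 0 < l := hs.trans_lt h
  have h1 : T * s + l ≠ 0 := by positivity
  rw [expNeg_kern_of_lt hT hs h]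
  field_simp
  ring

lemma measurable_kern (T s : ℝ) : Measurable (kern T s) :=
  Measurable.ite measurableSet_Iic measurable_const (by fun_prop)

lemma one_sub_expNeg_kern_mono {T s z l : ℝ} (hT : 0 < T) (hs : 0 ≤ s) (hsz : s ≤ z) :
    1 - expNeg (kern T s l) ≤ 1 - expNeg (kern T z l) := by
  rcases le_or_gt l z with h | h
  · rw [kern_of_le h, expNeg_top]
    linarith [expNeg_nonneg (kern T s l)]
  · have hl : 0 < l := (hs.trans hsz).trans_lt h
    rw [one_sub_expNeg_kern_of_lt hT hs (hsz.trans_lt h),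
      one_sub_expNeg_kern_of_lt hT (hs.trans hsz) h, div_le_div_iff₀ (by positivity)
        (by have := hs.trans hsz; positivity)]
    have : T * s ≤ T * z := by gcongr
    nlinarith

/-- The exponent of the Laplace functional of `kern T s` for the intensity `μ`. -/
noncomputable def kernExponent (μ : Measure ℝ) (T s : ℝ) : ℝ≥0∞ :=
  ∫⁻ l, ENNReal.ofReal (1 - expNeg (kern T s l)) ∂μ

lemma kernExponent_eq (μ : Measure ℝ) {T z : ℝ} (hT : 0 < T) (hz : 0 ≤ z) :
    kernExponent μ T z = μ (Iic z) + ∫⁻ l in Ioi z, ENNReal.ofReal (T * z / (T * z + l)) ∂μ := by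
  rw [kernExponent, ← lintegral_add_compl _ (measurableSet_Iic (a := z)), compl_Iic]
  congr 1
  · rw [← setLIntegral_one]
    exact setLIntegral_congr_fun measurableSet_Iic fun l hl => by simp [kern_of_le hl]
  · exact setLIntegral_congr_fun measurableSet_Ioi fun l hl => by
      simp only [one_sub_expNeg_kern_of_lt hT hz hl]

lemma tendsto_kernExponent {T z : ℝ} (hT : 0 < T) {τ : ℕ → ℝ} (h0 : ∀ n, 0 ≤ τ n)
    (hz : ∀ n, τ n < z) (hτ : Tendsto τ atTop (𝓝 z)) :
    Tendsto (fun n => kernExponent μ T (τ n)) atTop (𝓝 (kernExponent μ T z)) := by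
  have hz0 : 0 < z := (h0 0).trans_lt (hz 0)
  have hmeas : ∀ s, Measurable fun l => ENNReal.ofReal (1 - expNeg (kern T s l)) := fun s => by
    have := measurable_kern T s
    fun_prop
  have hup : ∀ n, kernExponent μ T (τ n) ≤ kernExponent μ T z := fun n =>
    lintegral_mono fun l => ENNReal.ofReal_le_ofReal (one_sub_expNeg_kern_mono hT (h0 n) (hz n).le)
  refine tendsto_of_le_liminf_of_limsup_le ?_ (limsup_le_of_le (by isBoundedDefault)
    (Eventually.of_forall hup))
  refine le_trans (le_of_eq ?_) (lintegral_liminf_le fun n => hmeas (τ n))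
  refine lintegral_congr_ae ?_
  have hne : ∀ᵐ l ∂μ, l ≠ z := by
    rw [ae_iff]; simp
  filter_upwards [hne] with l hl
  refine (Tendsto.liminf_eq ?_).symm
  refine (ENNReal.continuous_ofReal.tendsto _).comp ?_
  rcases lt_or_gt_of_ne hl with h | h
  · refine Tendsto.congr' ?_ tendsto_const_nhds
    filter_upwards [hτ.eventually (lt_mem_nhds h)] with n hn
    rw [kern_of_le h.le, kern_of_le (le_of_lt hn)]
  · rw [one_sub_expNeg_kern_of_lt hT hz0.le h]
    have hc : Tendsto (fun n => T * τ n / (T * τ n + l)) atTop (𝓝 (T * z / (T * z + l))) := by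
      have h1 : T * z + l ≠ 0 := by have := hz0.trans h; positivity
      exact (hτ.const_mul T).div ((hτ.const_mul T).add_const l) h1
    exact hc.congr fun n => (one_sub_expNeg_kern_of_lt hT (h0 n) ((hz n).trans h)).symm

/-- First-order comparison of `1 - exp (-x)` with `x`. -/
lemma exists_one_sub_expNeg_eq_mul : ∃ ψ : ℝ≥0∞ → ℝ≥0∞, (∀ x, x ≠ ∞ →
    ENNReal.ofReal (1 - expNeg x) = ψ x * x) ∧
    ∀ x, x ≠ ∞ → ENNReal.ofReal (expNeg x) ≤ ψ x ∧ ψ x ≤ 1 := by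
  classical
  refine ⟨fun x => if x = 0 then 1 else ENNReal.ofReal (1 - expNeg x) / x, fun x hx => ?_,
    fun x hx => ?_⟩
  · by_cases h : x = 0
    · simp [h]
    · simp only [if_neg h]
      rw [ENNReal.div_mul_cancel h hx]
  · by_cases h : x = 0
    · simp [h]
    · simp only [if_neg h]
      have hr : 0 ≤ x.toReal := ENNReal.toReal_nonneg
      have hxr : ENNReal.ofReal x.toReal = x := ENNReal.ofReal_toReal hx
      rw [expNeg_of_ne_top hx]
      constructor
      · rw [ENNReal.le_div_iff_mul_le (Or.inl h) (Or.inl hx)]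
        nth_rw 2 [← hxr]
        rw [← ENNReal.ofReal_mul (Real.exp_nonneg _)]
        refine ENNReal.ofReal_le_ofReal ?_
        have h1 := Real.add_one_le_exp x.toReal
        have h2 : Real.exp (-x.toReal) * Real.exp x.toReal = 1 := by
          rw [← Real.exp_add]; simp
        nlinarith [Real.exp_pos (-x.toReal)]
      · rw [ENNReal.div_le_iff_le_mul (Or.inl h) (Or.inl hx), one_mul]
        nth_rw 2 [← hxr]
        refine ENNReal.ofReal_le_ofReal ?_
        linarith [Real.add_one_le_exp (-x.toReal)]

/-- Riemann sums for the law of the minimum of a Poisson process on the half-line, weighted by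
`expNeg (∑ kern T s l)`, `s` being slightly less than the minimum. -/
theorem tendsto_sum_cells [IsLocallyFiniteMeasure μ] {T : ℝ} (hT : 0 < T) {c : ℝ → ℝ}
    (hc : Continuous c) (hc0 : ∀ z, 0 ≤ z → 0 ≤ c z) (hc1 : ∀ z, 0 ≤ z → c z ≤ 1) (R : ℕ) :
    Tendsto (fun n : ℕ => ∑ m ∈ Finset.range (R * (n + 1)),
        ENNReal.ofReal (c ((m : ℝ) / (n + 1)) * expNeg (kernExponent μ T ((m : ℝ) / (n + 1)))
          * (1 - expNeg (∫⁻ l in cell n m, ENNReal.ofReal (expNeg (kern T ((m : ℝ) / (n + 1)) l)) ∂μ))))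
      atTop (𝓝 (∫⁻ z in Ioc 0 (R : ℝ),
        ENNReal.ofReal (c z * expNeg (kernExponent μ T z) * (1 / (1 + T))) ∂μ)) := by
  obtain ⟨ψ, hψ, hψ1⟩ := exists_one_sub_expNeg_eq_mul
  let w : ℕ → ℕ → ℝ → ℝ≥0∞ := fun n m l => ENNReal.ofReal (expNeg (kern T ((m : ℝ) / (n + 1)) l))
  let a : ℕ → ℕ → ℝ := fun n m =>
    c ((m : ℝ) / (n + 1)) * expNeg (kernExponent μ T ((m : ℝ) / (n + 1)))
  let X : ℕ → ℕ → ℝ≥0∞ := fun n m => ∫⁻ l in cell n m, w n m l ∂μ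
  have hwm : ∀ n m, Measurable (w n m) := fun n m => by
    have := measurable_kern T ((m : ℝ) / (n + 1))
    simp only [w]; fun_prop
  have hw1 : ∀ n m l, w n m l ≤ 1 := fun n m l => by
    simp only [w, ENNReal.ofReal_le_one]; exact expNeg_le_one _
  have hXle : ∀ n m, X n m ≤ μ (cell n m) := fun n m => by
    rw [← setLIntegral_one]; exact lintegral_mono (hw1 n m)
  have hXtop : ∀ n m, X n m ≠ ∞ := fun n m =>
    ((hXle n m).trans_lt (measure_cell_lt_top μ n m)).ne
  have ha0 : ∀ n m, 0 ≤ a n m := fun n m =>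
    mul_nonneg (hc0 _ (by positivity)) (expNeg_nonneg _)
  have ha1 : ∀ n m, a n m ≤ 1 := fun n m =>
    mul_le_one₀ (hc1 _ (by positivity)) (expNeg_nonneg _) (expNeg_le_one _)
  have hsum : ∀ n, ∑ m ∈ Finset.range (R * (n + 1)),
      ENNReal.ofReal (a n m * (1 - expNeg (X n m)))
      = ∫⁻ z in Ioc 0 (R : ℝ), ENNReal.ofReal (a n (cellIndex n z)) * ψ (X n (cellIndex n z))
          * w n (cellIndex n z) z ∂μ := fun n => by
    rw [← sum_lintegral_cell_nat μ n R fun m z => ENNReal.ofReal (a n m) * ψ (X n m) * w n m z]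
    refine Finset.sum_congr rfl fun m _ => ?_
    rw [ENNReal.ofReal_mul (ha0 n m), hψ _ (hXtop n m), lintegral_const_mul _ (hwm n m), mul_assoc]
  refine Tendsto.congr (fun n => (hsum n).symm) ?_
  refine tendsto_lintegral_of_dominated_convergence (fun _ => 1) (fun n => ?_) (fun n => ?_) ?_ ?_
  · exact (measurable_cellIndex_comp n (f := fun m z => ENNReal.ofReal (a n m) * ψ (X n m) * w n m z)
      fun m => (hwm n m).const_mul _)
  · refine ae_of_all _ fun z => ?_
    have h1 : ENNReal.ofReal (a n (cellIndex n z)) ≤ 1 := ENNReal.ofReal_le_one.2 (ha1 _ _)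
    exact mul_le_one' (mul_le_one' h1 (hψ1 _ (hXtop _ _)).2) (hw1 _ _ _)
  · rw [setLIntegral_one]; exact measure_Ioc_lt_top.ne
  · refine (ae_restrict_iff' measurableSet_Ioc).2 (ae_of_all _ fun z hz => ?_)
    have hz0 : 0 < z := hz.1
    have hτ := tendsto_cellLeft hz0
    have hA : Tendsto (fun n => a n (cellIndex n z)) atTop
        (𝓝 (c z * expNeg (kernExponent μ T z))) :=
      ((hc.tendsto z).comp hτ).mul ((continuous_expNeg.tendsto _).comp
        (tendsto_kernExponent hT (fun n => cellLeft_nonneg n z) (fun n => cellLeft_lt hz0 n) hτ))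
    have hX0 : Tendsto (fun n => X n (cellIndex n z)) atTop (𝓝 0) :=
      tendsto_of_tendsto_of_tendsto_of_le_of_le tendsto_const_nhds (tendsto_measure_cell hz0)
        (fun n => bot_le) (fun n => hXle n _)
    have hψlim : Tendsto (fun n => ψ (X n (cellIndex n z))) atTop (𝓝 1) := by
      refine tendsto_of_tendsto_of_tendsto_of_le_of_le ?_ tendsto_const_nhds
        (fun n => (hψ1 _ (hXtop _ _)).1) (fun n => (hψ1 _ (hXtop _ _)).2)
      have := (ENNReal.continuous_ofReal.comp continuous_expNeg).tendsto 0 |>.comp hX0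
      simpa [Function.comp_def] using this
    have hw : Tendsto (fun n => w n (cellIndex n z) z) atTop (𝓝 (ENNReal.ofReal (1 / (1 + T)))) := by
      refine (ENNReal.continuous_ofReal.tendsto _).comp ?_
      have hlim : Tendsto (fun n => z / (T * cellLeft n z + z)) atTop (𝓝 (1 / (1 + T))) := by
        have h1 : T * z + z ≠ 0 := by positivity
        have h2 := (tendsto_const_nhds (x := z)).div ((hτ.const_mul T).add_const z) h1
        have h3 : z / (T * z + z) = 1 / (1 + T) := by field_simp; ring
        rwa [h3] at h2
      exact hlim.congr fun n => (expNeg_kern_of_lt hT (cellLeft_nonneg n z) (cellLeft_lt hz0 n)).symm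
    have hA0 : 0 ≤ c z * expNeg (kernExponent μ T z) :=
      mul_nonneg (hc0 z hz0.le) (expNeg_nonneg _)
    rw [ENNReal.ofReal_mul hA0]
    have h1 := ENNReal.Tendsto.mul (ENNReal.tendsto_ofReal hA) (Or.inr ENNReal.one_ne_top) hψlim
      (Or.inr ENNReal.ofReal_ne_top)
    rw [mul_one] at h1
    exact ENNReal.Tendsto.mul h1 (Or.inr ENNReal.ofReal_ne_top) hw (Or.inr ENNReal.ofReal_ne_top)

end Limit

namespace Network

/-! ### Almost sure properties of the path losses -/

variable {Ω : Type*} {net : Network Ω} {p : Params}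

/-- The path losses in sector `j` are positive, locally finite and pairwise distinct. -/
structure IsRegular (net : Network Ω) (p : Params) (j : Fin p.K) (ω : Ω) : Prop where
  pos : ∀ k, net.bs k ω ∈ p.bsSector j → 0 < net.pathLoss p k ω
  finite_le : ∀ R : ℕ, {k | net.bs k ω ∈ p.bsSector j ∧ net.pathLoss p k ω ≤ R}.Finite
  injective : ∀ k l, net.bs k ω ∈ p.bsSector j → net.bs l ω ∈ p.bsSector j →
    net.pathLoss p k ω = net.pathLoss p l ω → k = l

/-- The number of base stations in sector `j` whose path loss lies in `A`. -/
noncomputable def sectorCount (net : Network Ω) (p : Params) (j : Fin p.K) (A : Set ℝ) (ω : Ω) :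
    ℝ≥0∞ := net.sectorSum p j (A.indicator 1) ω

lemma sectorCount_eq_count (j : Fin p.K) (A : Set ℝ) (ω : Ω) :
    net.sectorCount p j A ω
      = Measure.count {k | net.bs k ω ∈ p.bsSector j ∧ net.pathLoss p k ω ∈ A} := by
  rw [← lintegral_indicator_one (by measurability), lintegral_count, sectorCount, sectorSum]
  refine tsum_congr fun k => ?_
  by_cases h1 : net.bs k ω ∈ p.bsSector j <;> by_cases h2 : net.pathLoss p k ω ∈ A <;>
    simp [indicator, h1, h2]

lemma sectorSum_const_mul (j : Fin p.K) (a : ℝ≥0∞) (G : ℝ → ℝ≥0∞) (ω : Ω) :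
    net.sectorSum p j (fun z => a * G z) ω = a * net.sectorSum p j G ω := by
  rw [sectorSum, sectorSum, ← ENNReal.tsum_mul_left]
  refine tsum_congr fun k => ?_
  by_cases h1 : net.bs k ω ∈ p.bsSector j <;> simp [indicator, h1]

lemma sectorCount_eq_zero_or_one_le (j : Fin p.K) (A : Set ℝ) (ω : Ω) :
    net.sectorCount p j A ω = 0 ∨ 1 ≤ net.sectorCount p j A ω := by
  rw [sectorCount_eq_count, Measure.count_apply (by measurability)]
  rcases Set.eq_empty_or_nonempty
    {k | net.bs k ω ∈ p.bsSector j ∧ net.pathLoss p k ω ∈ A} with h | h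
  · left; simp [h]
  · right
    have := Set.one_le_encard_iff_nonempty.2 h
    exact_mod_cast this

lemma two_le_sectorCount {j : Fin p.K} {A : Set ℝ} {ω : Ω} {k l : ℕ} (hkl : k ≠ l)
    (hk : net.bs k ω ∈ p.bsSector j) (hl : net.bs l ω ∈ p.bsSector j)
    (hkA : net.pathLoss p k ω ∈ A) (hlA : net.pathLoss p l ω ∈ A) :
    2 ≤ net.sectorCount p j A ω := by
  rw [sectorCount_eq_count]
  calc (2 : ℝ≥0∞) = Measure.count ({k, l} : Set ℕ) := by
        rw [Measure.count_apply (by measurability), Set.encard_pair hkl]; rfl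
    _ ≤ _ := by
        refine measure_mono ?_
        rintro i (rfl | rfl)
        · exact ⟨hk, hkA⟩
        · exact ⟨hl, hlA⟩

lemma ae_eq_zero_of_integral_expNeg_eq_one [MeasurableSpace Ω] {P : Measure Ω}
    [IsProbabilityMeasure P] {X : Ω → ℝ≥0∞} (hX : Measurable X)
    (h : ∫ ω, expNeg (X ω) ∂P = 1) : ∀ᵐ ω ∂P, X ω = 0 := by
  have hi := integrable_expNeg (P := P) hX
  have h1 : ∫ ω, (1 - expNeg (X ω)) ∂P = 0 := by
    rw [integral_sub (integrable_const _) hi, h]; simp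
  rw [integral_eq_zero_iff_of_nonneg (fun ω => sub_nonneg.2 (expNeg_le_one _))
    ((integrable_const _).sub hi)] at h1
  filter_upwards [h1] with ω hω
  have hω1 : expNeg (X ω) = 1 := by
    have : 1 - expNeg (X ω) = 0 := hω
    linarith
  have hne : X ω ≠ ∞ := fun h => by rw [h, expNeg_top] at hω1; exact zero_ne_one hω1
  rw [expNeg_of_ne_top hne, Real.exp_eq_one_iff, neg_eq_zero] at hω1
  exact ((ENNReal.toReal_eq_zero_iff _).1 hω1).resolve_right hne

variable [MeasurableSpace Ω] {P : Measure Ω}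

namespace HasModel

lemma measurable_bs (hnet : net.HasModel p P) (i : ℕ) : Measurable (net.bs i) :=
  hnet.poisson.measurable_points i

lemma measurable_sectorSum (hnet : net.HasModel p P) (j : Fin p.K) {G : ℝ → ℝ≥0∞}
    (hG : Measurable G) : Measurable (net.sectorSum p j G) :=
  Network.measurable_sectorSum p hnet.measurable_bs hnet.measurable_los j hG

lemma measurable_sectorCount (hnet : net.HasModel p P) (j : Fin p.K) {A : Set ℝ}
    (hA : MeasurableSet A) : Measurable (net.sectorCount p j A) :=
  hnet.measurable_sectorSum j (measurable_one.indicator hA)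

variable [IsProbabilityMeasure P]

/-- The Laplace transform of the Poisson law of the number of path losses in `A`. -/
lemma integral_expNeg_sectorCount (hnet : net.HasModel p P) (j : Fin p.K) {A : Set ℝ}
    (hA : MeasurableSet A) (a : ℝ≥0∞) :
    ∫ ω, expNeg (a * net.sectorCount p j A ω) ∂P
      = expNeg (ENNReal.ofReal (1 - expNeg a) * p.lossMeasure A) := by
  have hm : Measurable (A.indicator (1 : ℝ → ℝ≥0∞)) := measurable_one.indicator hA
  have h := hnet.integral_expNeg_sectorSum j (G := fun z => a * A.indicator 1 z) (hm.const_mul a)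
  simp_rw [sectorSum_const_mul] at h
  refine h.trans ?_
  rw [← lintegral_indicator_const hA]
  congr 1
  refine lintegral_congr fun z => ?_
  by_cases hz : z ∈ A <;> simp [hz]

lemma ae_pathLoss_pos (hnet : net.HasModel p P) (j : Fin p.K) :
    ∀ᵐ ω ∂P, ∀ k, net.bs k ω ∈ p.bsSector j → 0 < net.pathLoss p k ω := by
  have h := hnet.integral_expNeg_sectorCount j (measurableSet_Iic (a := (0 : ℝ))) ∞
  rw [p.lossMeasure_Iic_zero, mul_zero, expNeg_zero] at h
  filter_upwards [ae_eq_zero_of_integral_expNeg_eq_one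
    ((hnet.measurable_sectorCount j measurableSet_Iic).const_mul _) h] with ω hω k hk
  have h0 : net.sectorCount p j (Iic 0) ω = 0 := by simpa using hω
  rw [sectorCount_eq_count, Measure.count_eq_zero_iff] at h0
  by_contra hneg
  have : k ∈ {k | net.bs k ω ∈ p.bsSector j ∧ net.pathLoss p k ω ∈ Iic 0} := ⟨hk, not_lt.1 hneg⟩
  rw [h0] at this
  exact this

lemma ae_finite_pathLoss_le (hnet : net.HasModel p P) (j : Fin p.K) (R : ℕ) :
    ∀ᵐ ω ∂P, {k | net.bs k ω ∈ p.bsSector j ∧ net.pathLoss p k ω ≤ R}.Finite := by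
  classical
  set N : Ω → ℝ≥0∞ := net.sectorCount p j (Iic (R : ℝ)) with hN
  have hNm : Measurable N := hnet.measurable_sectorCount j measurableSet_Iic
  let Y : Ω → ℝ≥0∞ := fun ω => if N ω = ∞ then ∞ else 0
  have hYm : Measurable Y :=
    Measurable.ite (hNm (measurableSet_singleton ∞)) measurable_const measurable_const
  have hlim0 : Tendsto (fun n : ℕ => ((n : ℝ≥0∞))⁻¹) atTop (𝓝 0) :=
    ENNReal.tendsto_inv_nat_nhds_zero
  have h1 : Tendsto (fun n : ℕ => ∫ ω, expNeg ((n : ℝ≥0∞)⁻¹ * N ω) ∂P) atTop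
      (𝓝 (∫ ω, expNeg (Y ω) ∂P)) := by
    refine tendsto_integral_expNeg (fun n => hNm.const_mul _) (ae_of_all _ fun ω => ?_)
    by_cases h : N ω = ∞
    · simp only [Y, h, if_true]
      refine tendsto_const_nhds.congr fun n => ?_
      rw [ENNReal.mul_top (ENNReal.inv_ne_zero.2 (ENNReal.natCast_ne_top n))]
    · simp only [Y, h, if_false]
      simpa using ENNReal.Tendsto.mul_const hlim0 (Or.inr h)
  have h2 : Tendsto (fun n : ℕ => expNeg (ENNReal.ofReal (1 - expNeg ((n : ℝ≥0∞)⁻¹))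
      * p.lossMeasure (Iic (R : ℝ)))) atTop (𝓝 1) := by
    rw [← expNeg_zero]
    refine (continuous_expNeg.tendsto _).comp ?_
    have h3 : Tendsto (fun n : ℕ => ENNReal.ofReal (1 - expNeg ((n : ℝ≥0∞)⁻¹))) atTop (𝓝 0) := by
      have := ENNReal.tendsto_ofReal (((continuous_expNeg.tendsto 0).comp hlim0).const_sub 1)
      simpa using this
    simpa using ENNReal.Tendsto.mul_const h3 (Or.inr (p.lossMeasure_Iic_lt_top _).ne)
  have h3 : ∫ ω, expNeg (Y ω) ∂P = 1 :=
    tendsto_nhds_unique h1 (h2.congr fun n =>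
      (hnet.integral_expNeg_sectorCount j measurableSet_Iic _).symm)
  filter_upwards [ae_eq_zero_of_integral_expNeg_eq_one hYm h3] with ω hω
  have h4 : N ω ≠ ∞ := fun h => by simp [Y, h] at hω
  rw [hN, sectorCount_eq_count] at h4
  exact Measure.count_apply_lt_top.1 (lt_top_iff_ne_top.2 h4)

/-- The probability that a Poisson variable is at least `2` is at most the square of its mean. -/
lemma measure_two_le_sectorCount_le (hnet : net.HasModel p P) (j : Fin p.K) {A : Set ℝ}
    (hA : MeasurableSet A) (hfin : p.lossMeasure A ≠ ∞) :
    P {ω | 2 ≤ net.sectorCount p j A ω} ≤ p.lossMeasure A * p.lossMeasure A := by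
  set N : Ω → ℝ≥0∞ := net.sectorCount p j A with hN
  have hNm : Measurable N := hnet.measurable_sectorCount j hA
  set b : ℝ≥0∞ := ENNReal.ofReal (Real.log 2) with hb
  have hlog : 0 ≤ Real.log 2 := Real.log_nonneg (by norm_num)
  have hb2 : expNeg b = 1 / 2 := by
    rw [hb, expNeg_ofReal hlog, Real.exp_neg, Real.exp_log (by norm_num)]; norm_num
  -- `2 * (1 - 2 * 2⁻ᴺ + 0ᴺ)` vanishes for `N = 0, 1` and is at least `1` for `N ≥ 2`
  let f : Ω → ℝ := fun ω => 2 * (1 - 2 * expNeg (b * N ω) + expNeg (∞ * N ω))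
  have hi1 : Integrable (fun ω => expNeg (b * N ω)) P := integrable_expNeg (hNm.const_mul b)
  have hi2 : Integrable (fun ω => expNeg (∞ * N ω)) P := integrable_expNeg (hNm.const_mul ∞)
  have hi3 : Integrable (fun ω => 1 - 2 * expNeg (b * N ω)) P :=
    (integrable_const 1).sub (hi1.const_mul 2)
  have hf0 : ∀ ω, 0 ≤ f ω := fun ω => by
    simp only [f]
    rcases sectorCount_eq_zero_or_one_le (net := net) j A ω with h | h
    · simp only [hN, h, mul_zero, expNeg_zero]; norm_num
    · have h1 : expNeg (b * N ω) ≤ 1 / 2 := by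
        rw [← hb2]; exact expNeg_anti (le_mul_of_one_le_right' h)
      have h2 := expNeg_nonneg (∞ * N ω)
      linarith
  have hf1 : {ω | 2 ≤ N ω} ⊆ {ω | 1 ≤ f ω} := fun ω hω => by
    have hω' : 2 ≤ N ω := hω
    have h1 : expNeg (b * N ω) ≤ 1 / 4 := by
      have h2 : expNeg (b * 2) = 1 / 4 := by
        have := expNeg_natCast_mul 2 b
        rw [hb2] at this
        push_cast at this
        rw [this]; norm_num
      rw [← h2]; exact expNeg_anti (by gcongr)
    have h2 := expNeg_nonneg (∞ * N ω)
    show 1 ≤ f ω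
    simp only [f]; linarith
  have hint : ∫ ω, f ω ∂P
      = 2 * (1 - 2 * expNeg (ENNReal.ofReal (1 / 2) * p.lossMeasure A) + expNeg (p.lossMeasure A)) := by
    simp only [f]
    rw [integral_const_mul, integral_add hi3 hi2,
      integral_sub (integrable_const 1) (hi1.const_mul 2), integral_const_mul,
      hnet.integral_expNeg_sectorCount j hA, hnet.integral_expNeg_sectorCount j hA, hb2]
    norm_num
  have hfi : Integrable f P := (hi3.add hi2).const_mul 2
  have hmarkov := mul_meas_ge_le_integral_of_nonneg (ae_of_all _ hf0) hfi 1
  rw [one_mul, hint, expNeg_of_ne_top hfin, expNeg_of_ne_top (by finiteness), ENNReal.toReal_mul,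
    ENNReal.toReal_ofReal (by norm_num)] at hmarkov
  set x := (p.lossMeasure A).toReal with hx
  have hx0 : 0 ≤ x := ENNReal.toReal_nonneg
  have h1 : Real.exp (-x) = Real.exp (-(1 / 2 * x)) * Real.exp (-(1 / 2 * x)) := by
    rw [← Real.exp_add]; congr 1; ring
  have h2 : 1 - Real.exp (-(1 / 2 * x)) ≤ 1 / 2 * x := by
    linarith [Real.add_one_le_exp (-(1 / 2 * x))]
  have h3 : Real.exp (-(1 / 2 * x)) ≤ 1 := Real.exp_le_one_iff.2 (by linarith)
  have h4 : P.real {ω | 1 ≤ f ω} ≤ x * x := by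
    rw [h1] at hmarkov
    nlinarith
  calc P {ω | 2 ≤ N ω} ≤ P {ω | 1 ≤ f ω} := measure_mono hf1
    _ = ENNReal.ofReal (P.real {ω | 1 ≤ f ω}) := by simp
    _ ≤ ENNReal.ofReal (x * x) := ENNReal.ofReal_le_ofReal h4
    _ = _ := by rw [ENNReal.ofReal_mul hx0, hx, ENNReal.ofReal_toReal hfin]

lemma ae_pathLoss_injective (hnet : net.HasModel p P) (j : Fin p.K) (R : ℕ) :
    ∀ᵐ ω ∂P, ∀ k l, net.bs k ω ∈ p.bsSector j → net.bs l ω ∈ p.bsSector j →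
      net.pathLoss p k ω = net.pathLoss p l ω → net.pathLoss p k ω ∈ Ioc 0 (R : ℝ) → k = l := by
  rw [ae_iff]
  set B := {ω | ¬ ∀ k l, net.bs k ω ∈ p.bsSector j → net.bs l ω ∈ p.bsSector j →
      net.pathLoss p k ω = net.pathLoss p l ω → net.pathLoss p k ω ∈ Ioc 0 (R : ℝ) → k = l} with hB
  have hle : ∀ n : ℕ, P B ≤ ∑ m ∈ Finset.range (R * (n + 1)),
      p.lossMeasure (cell n m) * p.lossMeasure (cell n m) := by
    intro n
    have hsub : B ⊆ ⋃ m ∈ Finset.range (R * (n + 1)), {ω | 2 ≤ net.sectorCount p j (cell n m) ω} := by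
      intro ω hω
      simp only [hB, mem_ofPred_eq] at hω
      push Not at hω
      obtain ⟨k, l, hk, hl, heq, hmem, hne⟩ := hω
      have hcell := mem_cell_cellIndex hmem.1 n
      simp only [mem_iUnion]
      refine ⟨cellIndex n (net.pathLoss p k ω), ?_, two_le_sectorCount hne hk hl hcell (heq ▸ hcell)⟩
      have h1 : ⌈net.pathLoss p k ω * (n + 1)⌉₊ ≤ R * (n + 1) := by
        rw [Nat.ceil_le]
        push_cast
        exact mul_le_mul_of_nonneg_right hmem.2 (by positivity)
      have h2 : 0 < ⌈net.pathLoss p k ω * (n + 1)⌉₊ :=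
        Nat.ceil_pos.2 (mul_pos hmem.1 (by positivity))
      rw [Finset.mem_range, cellIndex]
      omega
    refine (measure_mono hsub).trans ((measure_biUnion_finset_le _ _).trans ?_)
    exact Finset.sum_le_sum fun m _ => hnet.measure_two_le_sectorCount_le j (measurableSet_cell n m)
      (measure_cell_lt_top _ n m).ne
  exact le_antisymm (ge_of_tendsto' (tendsto_sum_measure_cell_sq R) hle) bot_le

theorem ae_isRegular (hnet : net.HasModel p P) : ∀ᵐ ω ∂P, ∀ j, net.IsRegular p j ω := by
  rw [ae_all_iff]
  intro j
  filter_upwards [hnet.ae_pathLoss_pos j, ae_all_iff.2 (hnet.ae_finite_pathLoss_le j),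
    ae_all_iff.2 (hnet.ae_pathLoss_injective j)] with ω h1 h2 h3
  refine ⟨h1, h2, fun k l hk hl hkl => ?_⟩
  obtain ⟨R, hR⟩ := exists_nat_ge (net.pathLoss p k ω)
  exact h3 R k l hk hl hkl ⟨h1 k hk, hR⟩

end HasModel

end Network

/-! ### Independent exponential fading -/

lemma Params.effectiveNoise_nonneg (p : Params) : 0 ≤ p.effectiveNoise := by
  have hN : (1 : ℝ) ≤ p.Ncs := by exact_mod_cast p.Ncs_pos
  have hpi := Real.pi_pos
  have hθ : 2 * Real.pi / (p.Ncs : ℝ) ≤ 2 * Real.pi := div_le_self (by positivity) hN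
  have hgain : 0 ≤ p.userGain (2 * Real.pi / (p.Ncs : ℝ)) := by
    unfold Params.userGain
    split_ifs
    · exact zero_le_one
    · have : 0 ≤ p.frontBackRatio (2 * Real.pi / (p.Ncs : ℝ)) :=
        div_nonneg (by positivity) (mul_nonneg p.C₀_pos.le (sub_nonneg.2 hθ))
      positivity
  have := p.Pb_pos
  have := p.sigmaSq_nonneg
  unfold Params.effectiveNoise
  positivity

section Blocks

variable {Ω : Type*}

/-- The σ-algebra generated by the variables `F k`, `k ∈ J`. -/
@[reducible] def sigmaOf (F : ℕ → Ω → ℝ) (J : Set ℕ) : MeasurableSpace Ω :=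
  ⨆ k ∈ J, MeasurableSpace.comap (F k) inferInstance

lemma measurable_sigmaOf (F : ℕ → Ω → ℝ) {J : Set ℕ} {k : ℕ} (hk : k ∈ J) :
    Measurable[sigmaOf F J] (F k) :=
  (comap_measurable (F k)).mono (le_iSup₂ (f := fun k (_ : k ∈ J) =>
    MeasurableSpace.comap (F k) inferInstance) k hk) le_rfl

lemma sigmaOf_mono (F : ℕ → Ω → ℝ) {J J' : Set ℕ} (h : J ⊆ J') : sigmaOf F J ≤ sigmaOf F J' :=
  biSup_mono h

lemma measurable_tsum_sigmaOf (F : ℕ → Ω → ℝ) {J : Set ℕ} {u : ℕ → ℝ} (hu : ∀ k ∉ J, u k = 0) :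
    Measurable[sigmaOf F J] fun ω => ∑' k, ENNReal.ofReal (u k) * ENNReal.ofReal (F k ω) := by
  let _ : MeasurableSpace Ω := sigmaOf F J
  refine Measurable.tsum fun k => ?_
  by_cases hk : k ∈ J
  · exact (ENNReal.measurable_ofReal.comp (measurable_sigmaOf F hk)).const_mul _
  · simp only [hu k hk, ENNReal.ofReal_zero, zero_mul]
    exact measurable_const

lemma measurableSet_sigmaOf_tsum_lt (F : ℕ → Ω → ℝ) {J : Set ℕ} {u : ℕ → ℝ}
    (hu : ∀ k ∉ J, u k = 0) (c : ℝ≥0∞) {i : ℕ} (hi : i ∈ J) :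
    MeasurableSet[sigmaOf F J]
      {ω | ∑' k, ENNReal.ofReal (u k) * ENNReal.ofReal (F k ω) + c < ENNReal.ofReal (F i ω)} := by
  let _ : MeasurableSpace Ω := sigmaOf F J
  exact measurableSet_lt ((measurable_tsum_sigmaOf F hu).add_const c)
    (ENNReal.measurable_ofReal.comp (measurable_sigmaOf F hi))

end Blocks

section Exponential

variable {Ω : Type*} [MeasurableSpace Ω] {P : Measure Ω}

lemma expMeasure_lt_ofReal (y : ℝ≥0∞) :
    expMeasure 1 {x | y < ENNReal.ofReal x} = ENNReal.ofReal (expNeg y) := by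
  have := isProbabilityMeasure_expMeasure (r := 1) one_pos
  by_cases hy : y = ∞
  · simp [hy]
  have h1 : {x | y < ENNReal.ofReal x} = (Iic y.toReal)ᶜ := by
    ext x
    simp [ENNReal.lt_ofReal_iff_toReal_lt hy]
  rw [h1, ← ofReal_measureReal, probReal_compl_eq_one_sub measurableSet_Iic, ← cdf_eq_real,
    cdf_expMeasure_eq one_pos, if_pos ENNReal.toReal_nonneg, expNeg_of_ne_top hy]
  simp

/-- The tail of an exponential variable, at an independent level. -/
lemma measureReal_lt_ofReal_of_indepFun [IsProbabilityMeasure P] {X : Ω → ℝ} {Y : Ω → ℝ≥0∞}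
    (hX : HasLaw X (expMeasure 1) P)
    (hXm : Measurable X) (hY : Measurable Y) (hXY : IndepFun X Y P) :
    P.real {ω | Y ω < ENNReal.ofReal (X ω)} = ∫ ω, expNeg (Y ω) ∂P := by
  have := isProbabilityMeasure_expMeasure (r := 1) one_pos
  have hS : MeasurableSet {v : ℝ × ℝ≥0∞ | v.2 < ENNReal.ofReal v.1} :=
    measurableSet_lt (by fun_prop) (by fun_prop)
  have hmap := (indepFun_iff_map_prod_eq_prod_map_map hXm.aemeasurable hY.aemeasurable).1 hXY
  have h1 : P {ω | Y ω < ENNReal.ofReal (X ω)} = ∫⁻ ω, ENNReal.ofReal (expNeg (Y ω)) ∂P := by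
    have h2 : P {ω | Y ω < ENNReal.ofReal (X ω)}
        = P.map (fun ω => (X ω, Y ω)) {v : ℝ × ℝ≥0∞ | v.2 < ENNReal.ofReal v.1} :=
      (Measure.map_apply (hXm.prodMk hY) hS).symm
    have := Measure.isProbabilityMeasure_map (μ := P) hY.aemeasurable
    rw [h2, hmap, hX.map_eq, Measure.prod_apply_symm hS, lintegral_map
      (measurable_measure_prodMk_right hS) hY]
    exact lintegral_congr fun ω => expMeasure_lt_ofReal (Y ω)
  rw [measureReal_def, h1, ← ofReal_integral_eq_lintegral_ofReal (integrable_expNeg hY)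
    (ae_of_all _ fun ω => expNeg_nonneg _), ENNReal.toReal_ofReal
    (integral_nonneg fun ω => expNeg_nonneg _)]

/-- The Laplace transform of the exponential law. -/
lemma integral_expNeg_mul_of_hasLaw_exp {X : Ω → ℝ} (hX : HasLaw X (expMeasure 1) P) {a : ℝ}
    (ha : 0 ≤ a) :
    ∫ ω, expNeg (ENNReal.ofReal a * ENNReal.ofReal (X ω)) ∂P = 1 / (1 + a) := by
  have hm : Measurable fun x : ℝ => expNeg (ENNReal.ofReal a * ENNReal.ofReal x) := by fun_prop
  have h1 := hX.integral_comp (f := fun x => expNeg (ENNReal.ofReal a * ENNReal.ofReal x))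
    hm.aestronglyMeasurable
  simp only [Function.comp_def] at h1
  rw [h1, integral_eq_lintegral_of_nonneg_ae (ae_of_all _ fun x => expNeg_nonneg _)
    hm.aestronglyMeasurable]
  have h2 : expMeasure 1 = volume.withDensity (exponentialPDF 1) := rfl
  have hpdf : ∀ r, Measurable (exponentialPDF r) := fun r =>
    ENNReal.measurable_ofReal.comp (measurable_exponentialPDFReal r)
  have h3 : ∫⁻ x, ENNReal.ofReal (expNeg (ENNReal.ofReal a * ENNReal.ofReal x)) ∂(expMeasure 1)
      = ENNReal.ofReal (1 / (1 + a)) * ∫⁻ x, exponentialPDF (1 + a) x := by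
    rw [h2, lintegral_withDensity_eq_lintegral_mul _ (hpdf 1) (by fun_prop),
      ← lintegral_const_mul _ (hpdf _)]
    refine lintegral_congr fun x => ?_
    rw [Pi.mul_apply]
    rcases lt_or_ge x 0 with hx | hx
    · rw [exponentialPDF_of_neg hx, exponentialPDF_of_neg hx]; simp
    · rw [exponentialPDF_of_nonneg hx, exponentialPDF_of_nonneg hx, ← ENNReal.ofReal_mul ha,
        expNeg_ofReal (by positivity), ← ENNReal.ofReal_mul (by positivity),
        ← ENNReal.ofReal_mul (by positivity), one_mul, ← Real.exp_add]
      congr 1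
      rw [one_div, ← mul_assoc, inv_mul_cancel₀ (by positivity), one_mul]
      ring_nf
  rw [h3, lintegral_exponentialPDF_eq_one (by positivity), mul_one,
    ENNReal.toReal_ofReal (by positivity)]

/-- The Laplace transform of a weighted sum of independent exponential variables. -/
lemma integral_expNeg_tsum_mul_of_iIndepFun [IsProbabilityMeasure P] {F : ℕ → Ω → ℝ}
    (hF : ∀ k, HasLaw (F k) (expMeasure 1) P)
    (hFm : ∀ k, Measurable (F k)) (hind : iIndepFun F P) {u : ℕ → ℝ} (hu : ∀ k, 0 ≤ u k) :
    ∫ ω, expNeg (∑' k, ENNReal.ofReal (u k) * ENNReal.ofReal (F k ω)) ∂P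
      = expNeg (∑' k, ENNReal.ofReal (Real.log (1 + u k))) := by
  have h1 : Tendsto (fun n => ∫ ω, expNeg (∑ k ∈ Finset.range n,
      ENNReal.ofReal (u k) * ENNReal.ofReal (F k ω)) ∂P) atTop
      (𝓝 (∫ ω, expNeg (∑' k, ENNReal.ofReal (u k) * ENNReal.ofReal (F k ω)) ∂P)) :=
    tendsto_integral_expNeg (fun n => Finset.measurable_fun_sum _ fun k _ => by
      have := hFm k
      fun_prop) (ae_of_all _ fun ω => ENNReal.tendsto_nat_tsum _)
  have h2 : Tendsto (fun n => expNeg (∑ k ∈ Finset.range n, ENNReal.ofReal (Real.log (1 + u k))))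
      atTop (𝓝 (expNeg (∑' k, ENNReal.ofReal (Real.log (1 + u k))))) :=
    (continuous_expNeg.tendsto _).comp (ENNReal.tendsto_nat_tsum _)
  refine tendsto_nhds_unique h1 (h2.congr fun n => ?_)
  have h3 : iIndepFun (fun (k : Fin n) => F k) P := hind.precomp Fin.val_injective
  have h4 := h3.integral_fun_prod_comp
    (f := fun (k : Fin n) x => expNeg (ENNReal.ofReal (u k) * ENNReal.ofReal x))
    (fun k => (hFm k).aemeasurable) (fun k => Measurable.aestronglyMeasurable (by fun_prop))
  simp_rw [expNeg_sum, Finset.prod_range]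
  rw [h4]
  refine Finset.prod_congr rfl fun k _ => ?_
  rw [integral_expNeg_mul_of_hasLaw_exp (hF k) (hu k), expNeg_ofReal
    (Real.log_nonneg (by linarith [hu k])), Real.exp_neg, Real.exp_log (by linarith [hu k]), one_div]

lemma indep_sigmaOf {F : ℕ → Ω → ℝ} (hFm : ∀ k, Measurable (F k)) (hind : iIndepFun F P)
    {J J' : Set ℕ} (h : Disjoint J J') : Indep (sigmaOf F J) (sigmaOf F J') P :=
  indep_iSup_of_disjoint (fun k => (hFm k).comap_le) hind h

/-- Events depending on disjoint blocks of independent variables are independent. -/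
lemma measureReal_biInter_compl_eq_prod [IsProbabilityMeasure P] {ι : Type*} {F : ℕ → Ω → ℝ}
    (hFm : ∀ k, Measurable (F k)) (hind : iIndepFun F P) {J : ι → Set ℕ} (hJ : ∀ i j, i ≠ j → Disjoint (J i) (J j))
    {D : ι → Set Ω} (hD : ∀ i, MeasurableSet[sigmaOf F (J i)] (D i)) (s : Finset ι) :
    P.real (⋂ i ∈ s, (D i)ᶜ) = ∏ i ∈ s, (1 - P.real (D i)) := by
  classical
  have hle : ∀ J : Set ℕ, sigmaOf F J ≤ (inferInstance : MeasurableSpace Ω) := fun J =>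
    iSup₂_le fun k _ => (hFm k).comap_le
  induction s using Finset.induction_on with
  | empty => simp
  | insert a s ha ih =>
    have h1 : Disjoint (J a) (⋃ i ∈ s, J i) := by
      simp only [disjoint_iUnion_right]
      exact fun i hi => hJ a i fun h => ha (h ▸ hi)
    have h2 : MeasurableSet[sigmaOf F (⋃ i ∈ s, J i)] (⋂ i ∈ s, (D i)ᶜ) := by
      refine Finset.measurableSet_biInter _ fun i hi => ?_
      exact (sigmaOf_mono F (subset_biUnion_of_mem (u := J) hi) _ (hD i)).compl
    have h3 := ((indep_sigmaOf hFm hind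
      h1).indepSet_of_measurableSet (hD a).compl h2).measure_inter_eq_mul
    rw [Finset.prod_insert ha, ← ih, Finset.set_biInter_insert, measureReal_def, h3,
      ENNReal.toReal_mul, ← measureReal_def, ← measureReal_def,
      probReal_compl_eq_one_sub (hle _ _ (hD a))]

end Exponential

namespace Network

variable {Ω : Type*} {net : Network Ω} {p : Params}

lemma lt_sinr_iff (j : Fin p.K) (i : ℕ) (ω : Ω) (hi : 0 < net.pathLoss p i ω) :
    ENNReal.ofReal p.Gam < net.sinr p j i ω ↔
      ENNReal.ofReal (p.Gam * net.pathLoss p i ω) * (∑' k : net.interferers p j i ω, net.rxPower p k ω)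
        + ENNReal.ofReal (p.Gam * net.pathLoss p i ω * p.effectiveNoise)
        < ENNReal.ofReal (net.fading i ω) := by
  have hG : ENNReal.ofReal p.Gam ≠ 0 := by simpa using p.Gam_pos
  have hl : ENNReal.ofReal (net.pathLoss p i ω) ≠ 0 := by simpa using hi
  rw [sinr, ENNReal.lt_div_iff_mul_lt (Or.inr ENNReal.ofReal_ne_top) (Or.inr hG), rxPower,
    ENNReal.lt_div_iff_mul_lt (Or.inl hl) (Or.inl ENNReal.ofReal_ne_top),
    ENNReal.ofReal_mul (mul_nonneg p.Gam_pos.le hi.le), ENNReal.ofReal_mul p.Gam_pos.le]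
  refine iff_of_eq ?_
  congr 1
  ring

open Classical in
/-- The weights of the fading powers in the interference at sector `j`, normalised by the threshold
and the path loss of the serving base station `i`. -/
noncomputable def weight (net : Network Ω) (p : Params) (j : Fin p.K) (i : ℕ) (ω : Ω) (k : ℕ) : ℝ :=
  if k ∈ net.interferers p j i ω then p.Gam * net.pathLoss p i ω / net.pathLoss p k ω else 0

lemma weight_nonneg {j : Fin p.K} {i : ℕ} {ω : Ω} (hi : 0 < net.pathLoss p i ω) (k : ℕ) :
    0 ≤ net.weight p j i ω k := by
  unfold weight
  split_ifs with h
  · exact div_nonneg (mul_nonneg p.Gam_pos.le hi.le) (hi.trans h.2).le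
  · exact le_rfl

lemma mul_interference_eq {j : Fin p.K} {i : ℕ} {ω : Ω} (hi : 0 < net.pathLoss p i ω) :
    ENNReal.ofReal (p.Gam * net.pathLoss p i ω) * (∑' k : net.interferers p j i ω, net.rxPower p k ω)
      = ∑' k, ENNReal.ofReal (net.weight p j i ω k) * ENNReal.ofReal (net.fading k ω) := by
  rw [tsum_subtype (net.interferers p j i ω) fun k => net.rxPower p k ω, ← ENNReal.tsum_mul_left]
  refine tsum_congr fun k => ?_
  by_cases hk : k ∈ net.interferers p j i ω
  · rw [indicator_of_mem hk, weight, if_pos hk, rxPower, ENNReal.ofReal_div_of_pos (hi.trans hk.2)]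
    simp only [div_eq_mul_inv]
    ring
  · rw [indicator_of_notMem hk, weight, if_neg hk]; simp

/-- The network in which the positions and the LOS states are those of the outcome `ω`, while the
fading powers remain random. -/
def freeze (net : Network Ω) (ω : Ω) : Network Ω where
  bs i _ := net.bs i ω
  los i _ := net.los i ω
  fading := net.fading

lemma freeze_sectorDetected_eq {j : Fin p.K} {ω : Ω} (hreg : net.IsRegular p j ω) {i : ℕ}
    (hi : net.IsMinPathLoss p j i ω) :
    (net.freeze ω).sectorDetected p j
      = {ω' | ∑' k, ENNReal.ofReal (net.weight p j i ω k) * ENNReal.ofReal (net.fading k ω')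
          + ENNReal.ofReal (p.Gam * net.pathLoss p i ω * p.effectiveNoise)
          < ENNReal.ofReal (net.fading i ω')} := by
  have hpos := hreg.pos i hi.1
  ext ω'
  have key : ENNReal.ofReal p.Gam < (net.freeze ω).sinr p j i ω' ↔
      ∑' k, ENNReal.ofReal (net.weight p j i ω k) * ENNReal.ofReal (net.fading k ω')
          + ENNReal.ofReal (p.Gam * net.pathLoss p i ω * p.effectiveNoise)
          < ENNReal.ofReal (net.fading i ω') := by
    rw [lt_sinr_iff (net := net.freeze ω) j i ω' hpos,
      mul_interference_eq (net := net.freeze ω) (ω := ω') hpos]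
    rfl
  rw [mem_ofPred_eq, ← key]
  constructor
  · rintro ⟨i', hi', h⟩
    have heq : i' = i := hreg.injective i' i hi'.1 hi.1 (le_antisymm (hi'.2 i hi.1) (hi.2 i' hi'.1))
    rwa [heq] at h
  · exact fun h => ⟨i, hi, h⟩

lemma freeze_sectorDetected_eq_empty {j : Fin p.K} {ω : Ω}
    (h : ∀ k, net.bs k ω ∉ p.bsSector j) : (net.freeze ω).sectorDetected p j = ∅ := by
  rw [eq_empty_iff_forall_notMem]
  rintro ω' ⟨i, hi, -⟩
  exact h i hi.1

lemma IsRegular.exists_isMinPathLoss {j : Fin p.K} {ω : Ω} (hreg : net.IsRegular p j ω)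
    (h : ∃ k, net.bs k ω ∈ p.bsSector j) : ∃ i, net.IsMinPathLoss p j i ω := by
  obtain ⟨k, hk⟩ := h
  obtain ⟨R, hR⟩ := exists_nat_ge (net.pathLoss p k ω)
  obtain ⟨i, hi, hmin⟩ := (hreg.finite_le R).toFinset.exists_min_image (net.pathLoss p · ω)
    ⟨k, by simpa using ⟨hk, hR⟩⟩
  simp only [Finite.mem_toFinset, mem_ofPred_eq] at hi hmin
  refine ⟨i, hi.1, fun l hl => ?_⟩
  rcases le_or_gt (net.pathLoss p l ω) R with h | h
  · exact hmin l ⟨hl, h⟩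
  · exact hi.2.trans h.le

section Measurability

variable [MeasurableSpace Ω]

lemma measurableSet_sectorDetected (hb : ∀ i, Measurable (net.bs i))
    (hl : ∀ i, Measurable (net.los i)) (hf : ∀ i, Measurable (net.fading i)) (j : Fin p.K) :
    MeasurableSet (net.sectorDetected p j) := by
  have hpl := measurable_pathLoss p hb hl
  have hsec : ∀ k, MeasurableSet {ω | net.bs k ω ∈ p.bsSector j} := fun k =>
    hb k (p.measurableSet_bsSector j)
  have hrx : ∀ k, Measurable (net.rxPower p k) := fun k => by
    have := hpl k; have := hf k
    unfold rxPower
    fun_prop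
  have hsinr : ∀ i, Measurable (net.sinr p j i) := fun i => by
    have h1 : Measurable fun ω => ∑' k : net.interferers p j i ω, net.rxPower p k ω := by
      have h2 : (fun ω => ∑' k : net.interferers p j i ω, net.rxPower p k ω) = fun ω =>
          ∑' k, {ω | net.bs k ω ∈ p.bsSector j ∧ net.pathLoss p i ω < net.pathLoss p k ω}.indicator
            (net.rxPower p k) ω := by
        funext ω
        rw [tsum_subtype (net.interferers p j i ω) fun k => net.rxPower p k ω]
        rfl
      rw [h2]
      exact Measurable.tsum fun k =>
        (hrx k).indicator ((hsec k).inter (measurableSet_lt (hpl i) (hpl k)))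
    exact (hrx i).div (h1.add_const _)
  have heq : net.sectorDetected p j = ⋃ i, (({ω | net.bs i ω ∈ p.bsSector j} ∩
      ⋂ k, ({ω | net.bs k ω ∈ p.bsSector j}ᶜ ∪ {ω | net.pathLoss p i ω ≤ net.pathLoss p k ω})) ∩
      {ω | ENNReal.ofReal p.Gam < net.sinr p j i ω}) := by
    ext ω
    simp only [sectorDetected, IsMinPathLoss, mem_ofPred_eq, mem_iUnion, mem_inter_iff, mem_iInter,
      mem_union, mem_compl_iff, imp_iff_not_or]
  rw [heq]
  exact MeasurableSet.iUnion fun i => ((hsec i).inter (MeasurableSet.iInter fun k =>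
    (hsec k).compl.union (measurableSet_le (hpl i) (hpl k)))).inter
    (measurableSet_lt measurable_const (hsinr i))

end Measurability

namespace HasModel

variable [MeasurableSpace Ω] {P : Measure Ω} [IsProbabilityMeasure P]

/-- Since the fading powers are independent of everything else, the probability that none of
given sectors is detected is obtained by first integrating over the fading powers. -/
theorem measure_biInter_compl_eq_lintegral (hnet : net.HasModel p P) (s : Finset (Fin p.K)) :
    P (⋂ j ∈ s, (net.sectorDetected p j)ᶜ)
      = ∫⁻ ω, P (⋂ j ∈ s, ((net.freeze ω).sectorDetected p j)ᶜ) ∂P := by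
  let can : Network ((ℕ → ℝ) × ((ℕ → ℂ) × (ℕ → Bool))) :=
    { bs := fun i v => v.2.1 i, los := fun i v => v.2.2 i, fading := fun i v => v.1 i }
  let A : Ω → (ℕ → ℝ) := fun ω i => net.fading i ω
  let B : Ω → (ℕ → ℂ) × (ℕ → Bool) := fun ω => (fun i => net.bs i ω, fun i => net.los i ω)
  have hA : Measurable A := measurable_pi_lambda _ hnet.measurable_fading
  have hB : Measurable B := (measurable_pi_lambda _ hnet.measurable_bs).prodMk
    (measurable_pi_lambda _ hnet.measurable_los)
  set E : Set ((ℕ → ℝ) × ((ℕ → ℂ) × (ℕ → Bool))) := ⋂ j ∈ s, (can.sectorDetected p j)ᶜ with hE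
  have hEm : MeasurableSet E := Finset.measurableSet_biInter _ fun j _ =>
    (measurableSet_sectorDetected (net := can)
      (fun i => (measurable_pi_apply i).comp (measurable_fst.comp measurable_snd))
      (fun i => (measurable_pi_apply i).comp (measurable_snd.comp measurable_snd))
      (fun i => (measurable_pi_apply i).comp measurable_fst) j).compl
  have hmap := (indepFun_iff_map_prod_eq_prod_map_map hA.aemeasurable hB.aemeasurable).1
    hnet.indep_fading
  have h1 : (⋂ j ∈ s, (net.sectorDetected p j)ᶜ) = (fun ω => (A ω, B ω)) ⁻¹' E := by
    simp only [hE, preimage_iInter, preimage_compl]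
    rfl
  have := Measure.isProbabilityMeasure_map (μ := P) hA.aemeasurable
  have := Measure.isProbabilityMeasure_map (μ := P) hB.aemeasurable
  rw [h1, ← Measure.map_apply (hA.prodMk hB) hEm, hmap, Measure.prod_apply_symm hEm,
    lintegral_map (measurable_measure_prodMk_right hEm) hB]
  refine lintegral_congr fun ω => ?_
  rw [Measure.map_apply hA (measurable_prodMk_right hEm)]
  congr 1
  simp only [hE, preimage_iInter, preimage_compl]
  rfl

/-- Given positions and LOS states, the sectors are detected independently of each other. -/
lemma measureReal_biInter_freeze (hnet : net.HasModel p P) {ω : Ω}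
    (hreg : ∀ j, net.IsRegular p j ω) (s : Finset (Fin p.K)) :
    P.real (⋂ j ∈ s, ((net.freeze ω).sectorDetected p j)ᶜ)
      = ∏ j ∈ s, (1 - P.real ((net.freeze ω).sectorDetected p j)) := by
  refine measureReal_biInter_compl_eq_prod hnet.measurable_fading hnet.iIndep_fading
    (J := fun j => {k | net.bs k ω ∈ p.bsSector j}) (fun i j hij => ?_) (fun j => ?_) s
  · rw [Set.disjoint_left]
    exact fun k hi hj => Set.disjoint_left.1 (p.disjoint_bsSector hij) hi hj
  · by_cases h : ∃ k, net.bs k ω ∈ p.bsSector j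
    · obtain ⟨i, hi⟩ := (hreg j).exists_isMinPathLoss h
      rw [freeze_sectorDetected_eq (hreg j) hi]
      exact measurableSet_sigmaOf_tsum_lt net.fading (fun k hk => if_neg fun h' => hk h'.1) _ hi.1
    · push Not at h
      rw [freeze_sectorDetected_eq_empty h]
      exact @MeasurableSet.empty _ (_)

/-- The conditional probability that a sector is detected, given positions and LOS states. -/
lemma measureReal_freeze_sectorDetected (hnet : net.HasModel p P) {j : Fin p.K} {ω : Ω}
    (hreg : net.IsRegular p j ω) {i : ℕ} (hi : net.IsMinPathLoss p j i ω) :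
    P.real ((net.freeze ω).sectorDetected p j)
      = Real.exp (-(p.Gam * net.pathLoss p i ω * p.effectiveNoise))
        * expNeg (∑' k, ENNReal.ofReal (Real.log (1 + net.weight p j i ω k))) := by
  have hpos := hreg.pos i hi.1
  have hN : 0 ≤ p.Gam * net.pathLoss p i ω * p.effectiveNoise :=
    mul_nonneg (mul_nonneg p.Gam_pos.le hpos.le) p.effectiveNoise_nonneg
  have hJ : ∀ k ∉ ({i}ᶜ : Set ℕ), net.weight p j i ω k = 0 := fun k hk => by
    have : k = i := by simpa using hk
    rw [this]
    exact if_neg fun h => lt_irrefl _ h.2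
  have hYm := measurable_tsum_sigmaOf net.fading hJ
  have hle : sigmaOf net.fading ({i}ᶜ : Set ℕ) ≤ (inferInstance : MeasurableSpace Ω) :=
    iSup₂_le fun k _ => (hnet.measurable_fading k).comap_le
  set Y : Ω → ℝ≥0∞ := fun ω' =>
    ∑' k, ENNReal.ofReal (net.weight p j i ω k) * ENNReal.ofReal (net.fading k ω') with hY
  have hind : IndepFun (net.fading i) (fun ω' => Y ω' +
      ENNReal.ofReal (p.Gam * net.pathLoss p i ω * p.effectiveNoise)) P := by
    have h1 := indep_sigmaOf hnet.measurable_fading hnet.iIndep_fading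
      (disjoint_compl_right (a := ({i} : Set ℕ)))
    refine indep_of_indep_of_le_right (indep_of_indep_of_le_left h1 ?_) ?_
    · exact (measurable_sigmaOf net.fading (mem_singleton i)).comap_le
    · exact (hYm.add_const _).comap_le
  rw [freeze_sectorDetected_eq hreg hi, measureReal_lt_ofReal_of_indepFun (hnet.law_fading i)
    (hnet.measurable_fading i) ((hYm.mono hle le_rfl).add_const _) hind]
  simp_rw [expNeg_add]
  rw [integral_mul_const, expNeg_ofReal hN, mul_comm, hY, integral_expNeg_tsum_mul_of_iIndepFun
    hnet.law_fading hnet.measurable_fading hnet.iIndep_fading (weight_nonneg hpos)]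

end HasModel

end Network

/-! ### Approximation of the conditional detection probabilities -/

/-- The modification of `kern T s` which moreover excludes the path losses at most `s'`. -/
noncomputable def kernExcl (T s s' l : ℝ) : ℝ≥0∞ := if l ≤ s' then ∞ else kern T s l

lemma measurable_kernExcl (T s s' : ℝ) : Measurable (kernExcl T s s') :=
  Measurable.ite measurableSet_Iic measurable_const (measurable_kern T s)

lemma lintegral_one_sub_expNeg_kernExcl (μ : Measure ℝ) (T : ℝ) {s s' : ℝ} (h : s ≤ s') :
    ∫⁻ l, ENNReal.ofReal (1 - expNeg (kernExcl T s s' l)) ∂μ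
      = kernExponent μ T s + ∫⁻ l in Ioc s s', ENNReal.ofReal (expNeg (kern T s l)) ∂μ := by
  have hm := measurable_kern T s
  rw [← lintegral_indicator measurableSet_Ioc, kernExponent, ← lintegral_add_left (by fun_prop)]
  refine lintegral_congr fun l => ?_
  rcases le_or_gt l s with h1 | h1
  · simp [kernExcl, kern_of_le h1, h1.trans h, not_lt.2 h1]
  rcases le_or_gt l s' with h2 | h2
  · rw [indicator_of_mem (show l ∈ Ioc s s' from ⟨h1, h2⟩), kernExcl, if_pos h2,
      ← ENNReal.ofReal_add (sub_nonneg.2 (expNeg_le_one _)) (expNeg_nonneg _)]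
    simp
  · rw [indicator_of_notMem (fun h3 : l ∈ Ioc s s' => absurd h3.2 (not_le.2 h2)), kernExcl,
      if_neg (not_le.2 h2), add_zero]

/-- As `s` increases to the minimum, `log (1 + T s / l)` sums to its value at the minimum. -/
lemma tendsto_tsum_log_one_add {ι : Type*} {x : ι → ℝ} (hx : ∀ k, 0 ≤ x k) {θ : ℕ → ℝ}
    (h0 : ∀ n, 0 ≤ θ n) (h1 : ∀ n, θ n ≤ 1) (hθ : Tendsto θ atTop (𝓝 1)) :
    Tendsto (fun n => ∑' k, ENNReal.ofReal (Real.log (1 + θ n * x k))) atTop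
      (𝓝 (∑' k, ENNReal.ofReal (Real.log (1 + x k)))) := by
  -- concavity of the logarithm gives `θ log (1 + x) ≤ log (1 + θ x) ≤ log (1 + x)`
  have hlow : ∀ n k, θ n * Real.log (1 + x k) ≤ Real.log (1 + θ n * x k) := fun n k => by
    have hc := strictConcaveOn_log_Ioi.concaveOn.2 (mem_Ioi.2 one_pos)
      (show 1 + x k ∈ Ioi (0 : ℝ) by simp only [mem_Ioi]; linarith [hx k])
      (sub_nonneg.2 (h1 n)) (h0 n) (by ring)
    simp only [smul_eq_mul, Real.log_one, mul_zero, zero_add] at hc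
    refine hc.trans (le_of_eq ?_)
    congr 1; ring
  have hlim : Tendsto (fun n => ENNReal.ofReal (θ n) * ∑' k, ENNReal.ofReal (Real.log (1 + x k)))
      atTop (𝓝 (∑' k, ENNReal.ofReal (Real.log (1 + x k)))) := by
    have h2 : Tendsto (fun n => ENNReal.ofReal (θ n)) atTop (𝓝 1) := by
      simpa using ENNReal.tendsto_ofReal hθ
    simpa using ENNReal.Tendsto.mul_const h2 (Or.inl one_ne_zero)
  refine tendsto_of_tendsto_of_tendsto_of_le_of_le hlim tendsto_const_nhds (fun n => ?_) fun n => ?_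
  · simp only
    rw [← ENNReal.tsum_mul_left]
    refine ENNReal.tsum_le_tsum fun k => ?_
    rw [← ENNReal.ofReal_mul (h0 n)]
    exact ENNReal.ofReal_le_ofReal (hlow n k)
  · refine ENNReal.tsum_le_tsum fun k => ENNReal.ofReal_le_ofReal ?_
    have := mul_nonneg (h0 n) (hx k)
    refine Real.log_le_log (by linarith) ?_
    nlinarith [hx k, h1 n]

namespace Params

/-- The factor `exp (-Γ z σ²)` with the normalised noise power. -/
noncomputable def noiseFactor (p : Params) (z : ℝ) : ℝ := Real.exp (-(p.Gam * z * p.effectiveNoise))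

lemma noiseFactor_nonneg (p : Params) (z : ℝ) : 0 ≤ p.noiseFactor z := Real.exp_nonneg _

lemma noiseFactor_le_one (p : Params) {z : ℝ} (hz : 0 ≤ z) : p.noiseFactor z ≤ 1 :=
  Real.exp_le_one_iff.2 (neg_nonpos.2 (mul_nonneg (mul_nonneg p.Gam_pos.le hz)
    p.effectiveNoise_nonneg))

lemma continuous_noiseFactor (p : Params) : Continuous p.noiseFactor := by
  unfold noiseFactor; fun_prop

end Params

namespace Network

variable {Ω : Type*} {net : Network Ω} {p : Params}

/-- Approximation of the conditional probability that sector `j` is detected and has minimum path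
loss at most `R`, given positions and LOS states. The summand of a cell vanishes unless the cell
contains the minimum path loss; the factor `1 + Γ` compensates for the contribution of the
serving base station to `kern`. -/
noncomputable def approx (net : Network Ω) (p : Params) (R n : ℕ) (j : Fin p.K) (ω : Ω) : ℝ :=
  (1 + p.Gam) * ∑ m ∈ Finset.range (R * (n + 1)), p.noiseFactor ((m : ℝ) / (n + 1)) *
    (expNeg (net.sectorSum p j (kern p.Gam ((m : ℝ) / (n + 1))) ω)
      - expNeg (net.sectorSum p j (kernExcl p.Gam ((m : ℝ) / (n + 1)) (((m : ℝ) + 1) / (n + 1))) ω))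

lemma sectorSum_eq_top {j : Fin p.K} {G : ℝ → ℝ≥0∞} {ω : Ω} {k : ℕ}
    (hk : net.bs k ω ∈ p.bsSector j) (h : G (net.pathLoss p k ω) = ∞) :
    net.sectorSum p j G ω = ∞ :=
  ENNReal.tsum_eq_top_of_eq_top ⟨k, by rw [indicator_of_mem hk, h]⟩

lemma sectorSum_congr {j : Fin p.K} {G G' : ℝ → ℝ≥0∞} {ω : Ω}
    (h : ∀ k, net.bs k ω ∈ p.bsSector j → G (net.pathLoss p k ω) = G' (net.pathLoss p k ω)) :
    net.sectorSum p j G ω = net.sectorSum p j G' ω :=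
  tsum_congr fun k => by
    by_cases hk : net.bs k ω ∈ p.bsSector j
    · rw [indicator_of_mem hk, indicator_of_mem hk, h k hk]
    · rw [indicator_of_notMem hk, indicator_of_notMem hk]

lemma expNeg_sub_expNeg_eq_zero_of_lt {j : Fin p.K} {ω : Ω} (T s : ℝ) {s' : ℝ}
    (h : ∀ k, net.bs k ω ∈ p.bsSector j → s' < net.pathLoss p k ω) :
    expNeg (net.sectorSum p j (kern T s) ω) - expNeg (net.sectorSum p j (kernExcl T s s') ω) = 0 := by
  rw [sectorSum_congr (G := kernExcl T s s') (G' := kern T s)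
    fun k hk => if_neg (not_le.2 (h k hk)), sub_self]

lemma expNeg_sub_expNeg_eq_zero_of_le {j : Fin p.K} {ω : Ω} (T : ℝ) {s s' : ℝ} (hs : s ≤ s') {k : ℕ}
    (hk : net.bs k ω ∈ p.bsSector j) (h : net.pathLoss p k ω ≤ s) :
    expNeg (net.sectorSum p j (kern T s) ω) - expNeg (net.sectorSum p j (kernExcl T s s') ω) = 0 := by
  rw [sectorSum_eq_top hk (kern_of_le h), sectorSum_eq_top hk (if_pos (h.trans hs)), sub_self]

lemma approx_eq_zero_of_isEmpty {j : Fin p.K} {ω : Ω} (h : ∀ k, net.bs k ω ∉ p.bsSector j)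
    (R n : ℕ) : net.approx p R n j ω = 0 := by
  rw [approx, Finset.sum_eq_zero, mul_zero]
  intro m _
  rw [expNeg_sub_expNeg_eq_zero_of_lt _ _ (fun k hk => absurd hk (h k)), mul_zero]

lemma cellRight_le {R n m : ℕ} (hm : m < R * (n + 1)) : ((m : ℝ) + 1) / (n + 1) ≤ R := by
  rw [div_le_iff₀ (by positivity)]
  exact_mod_cast hm

lemma approx_eq_zero_of_lt {j : Fin p.K} {ω : Ω} {i : ℕ} (hi : net.IsMinPathLoss p j i ω)
    {R : ℕ} (hR : (R : ℝ) < net.pathLoss p i ω) (n : ℕ) : net.approx p R n j ω = 0 := by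
  rw [approx, Finset.sum_eq_zero, mul_zero]
  intro m hm
  rw [expNeg_sub_expNeg_eq_zero_of_lt _ _ (fun k hk => ?_), mul_zero]
  exact (cellRight_le (Finset.mem_range.1 hm)).trans_lt (hR.trans_le (hi.2 k hk))

lemma approx_eq_of_le {j : Fin p.K} {ω : Ω} {i : ℕ} (hi : net.IsMinPathLoss p j i ω)
    (hpos : 0 < net.pathLoss p i ω) {R : ℕ} (hR : net.pathLoss p i ω ≤ R) (n : ℕ) :
    net.approx p R n j ω = (1 + p.Gam) * (p.noiseFactor (cellLeft n (net.pathLoss p i ω)) *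
      expNeg (net.sectorSum p j (kern p.Gam (cellLeft n (net.pathLoss p i ω))) ω)) := by
  set Z := net.pathLoss p i ω with hZ
  have hcell := mem_cell_cellIndex hpos n
  rw [approx, Finset.sum_eq_single (cellIndex n Z)]
  · rw [sectorSum_eq_top (G := kernExcl _ _ _) hi.1 (if_pos hcell.2), expNeg_top, sub_zero]
    rfl
  · intro m _ hne
    rcases lt_or_ge ((m : ℝ) / (n + 1)) Z with h1 | h1
    · have h2 : ((m : ℝ) + 1) / (n + 1) < Z := by
        by_contra h3
        exact hne ((mem_cell_iff hpos).1 ⟨h1, not_lt.1 h3⟩).symm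
      rw [expNeg_sub_expNeg_eq_zero_of_lt _ _ (fun k hk => h2.trans_le (hi.2 k hk)), mul_zero]
    · rw [expNeg_sub_expNeg_eq_zero_of_le _ (by gcongr; linarith) hi.1 h1, mul_zero]
  · intro h
    exfalso
    have h1 : R * (n + 1) ≤ cellIndex n Z := by simpa using h
    have h2 : (R : ℝ) ≤ cellIndex n Z / (n + 1) := by
      rw [le_div_iff₀ (by positivity)]
      exact_mod_cast h1
    exact absurd (hcell.1) (not_lt.2 (hR.trans h2))

lemma approx_mem_Icc {j : Fin p.K} {ω : Ω} (hreg : net.IsRegular p j ω) (R n : ℕ) :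
    net.approx p R n j ω ∈ Icc 0 (1 + p.Gam) := by
  have hG := p.Gam_pos
  by_cases h : ∃ k, net.bs k ω ∈ p.bsSector j
  · obtain ⟨i, hi⟩ := hreg.exists_isMinPathLoss h
    rcases le_or_gt (net.pathLoss p i ω) R with hR | hR
    · rw [approx_eq_of_le hi (hreg.pos i hi.1) hR]
      have h1 := p.noiseFactor_nonneg (cellLeft n (net.pathLoss p i ω))
      have h2 := p.noiseFactor_le_one (cellLeft_nonneg n (net.pathLoss p i ω))
      have h3 := expNeg_nonneg (net.sectorSum p j (kern p.Gam (cellLeft n (net.pathLoss p i ω))) ω)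
      have h4 := expNeg_le_one (net.sectorSum p j (kern p.Gam (cellLeft n (net.pathLoss p i ω))) ω)
      exact ⟨by positivity, mul_le_of_le_one_right (by positivity) (mul_le_one₀ h2 h3 h4)⟩
    · rw [approx_eq_zero_of_lt hi hR]; exact ⟨le_rfl, by positivity⟩
  · push Not at h
    rw [approx_eq_zero_of_isEmpty h]; exact ⟨le_rfl, by positivity⟩

lemma tendsto_sectorSum_kern {j : Fin p.K} {ω : Ω} (hreg : net.IsRegular p j ω) {i : ℕ}
    (hi : net.IsMinPathLoss p j i ω) :
    Tendsto (fun n => net.sectorSum p j (kern p.Gam (cellLeft n (net.pathLoss p i ω))) ω) atTop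
      (𝓝 (ENNReal.ofReal (Real.log (1 + p.Gam))
        + ∑' k, ENNReal.ofReal (Real.log (1 + net.weight p j i ω k)))) := by
  classical
  have hpos := hreg.pos i hi.1
  set Z := net.pathLoss p i ω with hZ
  let x : ℕ → ℝ := fun k => if net.bs k ω ∈ p.bsSector j then p.Gam * Z / net.pathLoss p k ω else 0
  have hx : ∀ k, 0 ≤ x k := fun k => by
    simp only [x]
    split_ifs with h
    · exact div_nonneg (mul_nonneg p.Gam_pos.le hpos.le) (hreg.pos k h).le
    · exact le_rfl
  have hlim : ENNReal.ofReal (Real.log (1 + p.Gam))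
      + ∑' k, ENNReal.ofReal (Real.log (1 + net.weight p j i ω k))
      = ∑' k, ENNReal.ofReal (Real.log (1 + x k)) := by
    rw [← tsum_ite_eq i (fun _ => ENNReal.ofReal (Real.log (1 + p.Gam))), ← ENNReal.tsum_add]
    refine tsum_congr fun k => ?_
    by_cases hki : k = i
    · subst hki
      have hw : net.weight p j k ω k = 0 := if_neg fun h => lt_irrefl _ h.2
      have hxk : x k = p.Gam := by
        simp only [x, if_pos hi.1]
        rw [← hZ]; field_simp
      simp [hw, hxk]
    · rw [if_neg hki, zero_add]
      congr 3
      by_cases hk : net.bs k ω ∈ p.bsSector j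
      · have hlt : Z < net.pathLoss p k ω :=
          lt_of_le_of_ne (hi.2 k hk) fun h => hki (hreg.injective k i hk hi.1 h.symm)
        simp only [x, if_pos hk]
        exact if_pos ⟨hk, hlt⟩
      · simp only [x, if_neg hk]
        exact if_neg fun h => hk h.1
  rw [hlim]
  have hθ : Tendsto (fun n => cellLeft n Z / Z) atTop (𝓝 1) := by
    simpa [hpos.ne'] using (tendsto_cellLeft hpos).div_const Z
  refine (tendsto_tsum_log_one_add hx (fun n => div_nonneg (cellLeft_nonneg n Z) hpos.le)
    (fun n => (div_le_one hpos).2 (cellLeft_lt hpos n).le) hθ).congr fun n => ?_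
  refine tsum_congr fun k => ?_
  by_cases hk : net.bs k ω ∈ p.bsSector j
  · rw [indicator_of_mem hk, kern_of_lt ((cellLeft_lt hpos n).trans_le (hi.2 k hk))]
    simp only [x, if_pos hk]
    congr 3
    field_simp
  · rw [indicator_of_notMem hk]
    simp [x, if_neg hk]

variable [MeasurableSpace Ω] {P : Measure Ω}

open Classical in
/-- The conditional probability, given positions and LOS states, that sector `j` is detected and has
minimum path loss at most `R`. -/
noncomputable def condProb (net : Network Ω) (p : Params) (P : Measure Ω) (R : ℕ) (j : Fin p.K)
    (ω : Ω) : ℝ :=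
  if ∃ i, net.IsMinPathLoss p j i ω ∧ net.pathLoss p i ω ≤ R then
    P.real ((net.freeze ω).sectorDetected p j) else 0

lemma condProb_mem_Icc [IsProbabilityMeasure P] (R : ℕ) (j : Fin p.K) (ω : Ω) :
    net.condProb p P R j ω ∈ Icc (0 : ℝ) 1 := by
  unfold condProb
  split_ifs
  · exact ⟨measureReal_nonneg, measureReal_le_one⟩
  · exact ⟨le_rfl, zero_le_one⟩

lemma tendsto_condProb {j : Fin p.K} {ω : Ω} (hreg : net.IsRegular p j ω) :
    Tendsto (fun R => net.condProb p P R j ω) atTop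
      (𝓝 (P.real ((net.freeze ω).sectorDetected p j))) := by
  by_cases h : ∃ k, net.bs k ω ∈ p.bsSector j
  · obtain ⟨i, hi⟩ := hreg.exists_isMinPathLoss h
    obtain ⟨R₀, hR₀⟩ := exists_nat_ge (net.pathLoss p i ω)
    refine tendsto_const_nhds.congr' ?_
    filter_upwards [eventually_ge_atTop R₀] with R hR
    exact (if_pos ⟨i, hi, hR₀.trans (by exact_mod_cast hR)⟩).symm
  · push Not at h
    refine tendsto_const_nhds.congr fun R => ?_
    rw [freeze_sectorDetected_eq_empty h, measureReal_empty, condProb, if_neg]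
    rintro ⟨i, hi, -⟩
    exact absurd hi.1 (h i)

namespace HasModel

lemma tendsto_approx [IsProbabilityMeasure P] (hnet : net.HasModel p P) {j : Fin p.K} {ω : Ω}
    (hreg : net.IsRegular p j ω) (R : ℕ) :
    Tendsto (fun n => net.approx p R n j ω) atTop (𝓝 (net.condProb p P R j ω)) := by
  by_cases h : ∃ k, net.bs k ω ∈ p.bsSector j
  · obtain ⟨i, hi⟩ := hreg.exists_isMinPathLoss h
    have hpos := hreg.pos i hi.1
    rcases le_or_gt (net.pathLoss p i ω) R with hR | hR
    · rw [condProb, if_pos ⟨i, hi, hR⟩, hnet.measureReal_freeze_sectorDetected hreg hi]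
      have hG := p.Gam_pos
      have h1 := (((p.continuous_noiseFactor.tendsto _).comp (tendsto_cellLeft hpos)).mul
        ((continuous_expNeg.tendsto _).comp (tendsto_sectorSum_kern hreg hi))).const_mul (1 + p.Gam)
      rw [expNeg_add, expNeg_ofReal (Real.log_nonneg (by linarith)), Real.exp_neg,
        Real.exp_log (by linarith)] at h1
      refine (h1.congr fun n => (approx_eq_of_le hi hpos hR n).symm).trans_eq ?_
      congr 1
      rw [Params.noiseFactor]
      field_simp
    · rw [condProb, if_neg]
      · exact tendsto_const_nhds.congr fun n => (approx_eq_zero_of_lt hi hR n).symm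
      · rintro ⟨i', hi', h'⟩
        exact absurd (hR.trans_le ((hi.2 i' hi'.1).trans h')) (lt_irrefl _)
  · push Not at h
    rw [condProb, if_neg]
    · exact tendsto_const_nhds.congr fun n => (approx_eq_zero_of_isEmpty h R n).symm
    · rintro ⟨i, hi, -⟩
      exact absurd hi.1 (h i)

end HasModel

end Network

/-! ### The detection probability -/

/-- The mean of `approx`. -/
noncomputable def Params.approxMean (p : Params) (R n : ℕ) : ℝ :=
  (1 + p.Gam) * ∑ m ∈ Finset.range (R * (n + 1)), p.noiseFactor ((m : ℝ) / (n + 1)) *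
    (expNeg (∫⁻ z, ENNReal.ofReal (1 - expNeg (kern p.Gam ((m : ℝ) / (n + 1)) z)) ∂p.lossMeasure)
      - expNeg (∫⁻ z, ENNReal.ofReal (1 - expNeg
          (kernExcl p.Gam ((m : ℝ) / (n + 1)) (((m : ℝ) + 1) / (n + 1)) z)) ∂p.lossMeasure))

namespace Network

variable {Ω : Type*} [MeasurableSpace Ω] {net : Network Ω} {p : Params} {P : Measure Ω}

namespace HasModel

lemma measurable_approx (hnet : net.HasModel p P) (R n : ℕ) (j : Fin p.K) :
    Measurable (net.approx p R n j) := by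
  refine Measurable.const_mul (Finset.measurable_fun_sum _ fun m _ => Measurable.const_mul ?_ _) _
  exact (measurable_expNeg.comp (hnet.measurable_sectorSum j (measurable_kern _ _))).sub
    (measurable_expNeg.comp (hnet.measurable_sectorSum j (measurable_kernExcl _ _ _)))

variable [IsProbabilityMeasure P]

/-- Linear combinations of Laplace functionals of different sectors are uncorrelated. -/
lemma integral_prod_sum_expNeg (hnet : net.HasModel p P) {ι : Type*} [Fintype ι]
    (a : Fin p.K → ι → ℝ) (G : ι → ℝ → ℝ≥0∞) (hG : ∀ i, Measurable (G i)) :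
    ∫ ω, ∏ j, ∑ i, a j i * expNeg (net.sectorSum p j (G i) ω) ∂P
      = ∏ j, ∑ i, a j i * expNeg (∫⁻ z, ENNReal.ofReal (1 - expNeg (G i z)) ∂p.lossMeasure) := by
  classical
  simp_rw [Finset.prod_univ_sum, Finset.prod_mul_distrib]
  rw [integral_finsetSum]
  · refine Finset.sum_congr rfl fun v _ => ?_
    rw [integral_const_mul, hnet.integral_prod_expNeg_sectorSum (fun j => G (v j))
      fun j => hG (v j)]
  · intro v _
    simp_rw [← expNeg_sum]
    exact (integrable_expNeg (Finset.measurable_fun_sum _ fun j _ =>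
      hnet.measurable_sectorSum j (hG (v j)))).const_mul _

lemma integral_prod_one_sub_approx (hnet : net.HasModel p P) (R n : ℕ) (s : Finset (Fin p.K)) :
    ∫ ω, ∏ j ∈ s, (1 - net.approx p R n j ω) ∂P = (1 - p.approxMean R n) ^ s.card := by
  classical
  let M := R * (n + 1)
  let c : ℕ → ℝ := fun m => (1 + p.Gam) * p.noiseFactor ((m : ℝ) / (n + 1))
  -- `1 - approx` as a linear combination of Laplace functionals
  let a : Fin p.K → Unit ⊕ (Fin M ⊕ Fin M) → ℝ := fun j =>
    Sum.elim (fun _ => 1) (Sum.elim (fun m => if j ∈ s then -c m else 0)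
      (fun m => if j ∈ s then c m else 0))
  let G : Unit ⊕ (Fin M ⊕ Fin M) → ℝ → ℝ≥0∞ :=
    Sum.elim (fun _ _ => 0) (Sum.elim (fun m => kern p.Gam (((m : ℕ) : ℝ) / (n + 1)))
      (fun m => kernExcl p.Gam (((m : ℕ) : ℝ) / (n + 1)) ((((m : ℕ) : ℝ) + 1) / (n + 1))))
  have hG : ∀ i, Measurable (G i) := by
    rintro (_ | m | m)
    · exact measurable_const
    · exact measurable_kern _ _
    · exact measurable_kernExcl _ _ _
  have key : ∀ (L : (ℝ → ℝ≥0∞) → ℝ), L (fun _ => 0) = 1 → ∀ j,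
      ∑ i, a j i * L (G i) = if j ∈ s then
        1 - (1 + p.Gam) * ∑ m ∈ Finset.range M, p.noiseFactor ((m : ℝ) / (n + 1)) *
          (L (kern p.Gam ((m : ℝ) / (n + 1)))
            - L (kernExcl p.Gam ((m : ℝ) / (n + 1)) (((m : ℝ) + 1) / (n + 1)))) else 1 := by
    intro L hL j
    rw [Fintype.sum_sum_type, Fintype.sum_sum_type]
    simp only [a, G, Sum.elim_inl, Sum.elim_inr, Finset.univ_unique, Finset.sum_singleton, hL]
    by_cases hj : j ∈ s
    · simp only [if_pos hj]
      rw [Finset.sum_range, Finset.mul_sum, ← Finset.sum_add_distrib, one_mul, sub_eq_add_neg,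
        ← Finset.sum_neg_distrib]
      congr 1
      refine Finset.sum_congr rfl fun m _ => ?_
      simp only [c]; ring
    · simp [if_neg hj]
  have h := hnet.integral_prod_sum_expNeg a G hG
  have h0 : ∀ j ω, net.sectorSum p j (fun _ => 0) ω = 0 := fun j ω => by simp [sectorSum]
  have hR : ∀ j, ∑ i, a j i * expNeg (∫⁻ z, ENNReal.ofReal (1 - expNeg (G i z)) ∂p.lossMeasure)
      = if j ∈ s then 1 - p.approxMean R n else 1 :=
    key (fun g => expNeg (∫⁻ z, ENNReal.ofReal (1 - expNeg (g z)) ∂p.lossMeasure)) (by simp)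
  have hL : ∀ ω j, ∑ i, a j i * expNeg (net.sectorSum p j (G i) ω)
      = if j ∈ s then 1 - net.approx p R n j ω else 1 := fun ω j =>
    key (fun g => expNeg (net.sectorSum p j g ω)) (by simp [h0]) j
  simp_rw [hL, hR] at h
  simpa [Finset.prod_ite_mem, Finset.prod_const] using h

lemma tendsto_integral_prod_one_sub_approx (hnet : net.HasModel p P) (R : ℕ)
    (s : Finset (Fin p.K)) :
    Tendsto (fun n => ∫ ω, ∏ j ∈ s, (1 - net.approx p R n j ω) ∂P) atTop
      (𝓝 (∫ ω, ∏ j ∈ s, (1 - net.condProb p P R j ω) ∂P)) := by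
  have hG := p.Gam_pos
  refine tendsto_integral_of_dominated_convergence (fun _ => ∏ _j ∈ s, (1 + p.Gam))
    (fun n => (Finset.measurable_fun_prod _ fun j _ =>
      (hnet.measurable_approx R n j).const_sub 1).aestronglyMeasurable) (integrable_const _)
    (fun n => ?_) ?_
  · filter_upwards [hnet.ae_isRegular] with ω hω
    rw [norm_prod]
    refine Finset.prod_le_prod (fun _ _ => norm_nonneg _) fun j _ => ?_
    have h := approx_mem_Icc (hω j) R n
    rw [Real.norm_eq_abs, abs_le]
    constructor <;> linarith [h.1, h.2]
  · filter_upwards [hnet.ae_isRegular] with ω hω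
    exact tendsto_finsetProd _ fun j _ => (hnet.tendsto_approx (hω j) R).const_sub 1

lemma tendsto_integral_prod_one_sub_condProb (hnet : net.HasModel p P) (s : Finset (Fin p.K)) :
    Tendsto (fun R => ∫ ω, ∏ j ∈ s, (1 - net.condProb p P R j ω) ∂P) atTop
      (𝓝 (P.real (⋂ j ∈ s, (net.sectorDetected p j)ᶜ))) := by
  have hmeas : ∀ R, AEStronglyMeasurable (fun ω => ∏ j ∈ s, (1 - net.condProb p P R j ω)) P := by
    intro R
    refine aestronglyMeasurable_of_tendsto_ae atTop (f := fun n ω =>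
      ∏ j ∈ s, (1 - net.approx p R n j ω)) (fun n => (Finset.measurable_fun_prod _ fun j _ =>
        (hnet.measurable_approx R n j).const_sub 1).aestronglyMeasurable) ?_
    filter_upwards [hnet.ae_isRegular] with ω hω
    exact tendsto_finsetProd _ fun j _ => (hnet.tendsto_approx (hω j) R).const_sub 1
  have hlim : ∀ᵐ ω ∂P, Tendsto (fun R => ∏ j ∈ s, (1 - net.condProb p P R j ω)) atTop
      (𝓝 (∏ j ∈ s, (1 - P.real ((net.freeze ω).sectorDetected p j)))) := by
    filter_upwards [hnet.ae_isRegular] with ω hω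
    exact tendsto_finsetProd _ fun j _ => (tendsto_condProb (hω j)).const_sub 1
  have h1 : Tendsto (fun R => ∫ ω, ∏ j ∈ s, (1 - net.condProb p P R j ω) ∂P) atTop
      (𝓝 (∫ ω, ∏ j ∈ s, (1 - P.real ((net.freeze ω).sectorDetected p j)) ∂P)) := by
    refine tendsto_integral_of_dominated_convergence (fun _ => 1) hmeas (integrable_const _)
      (fun R => ae_of_all _ fun ω => ?_) hlim
    rw [norm_prod]
    refine Finset.prod_le_one (fun _ _ => norm_nonneg _) fun j _ => ?_
    have h := condProb_mem_Icc (net := net) (P := P) R j ω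
    rw [Real.norm_eq_abs, abs_le]
    constructor <;> linarith [h.1, h.2]
  have h2 : P.real (⋂ j ∈ s, (net.sectorDetected p j)ᶜ)
      = ∫ ω, ∏ j ∈ s, (1 - P.real ((net.freeze ω).sectorDetected p j)) ∂P := by
    rw [measureReal_def, hnet.measure_biInter_compl_eq_lintegral s,
      integral_eq_lintegral_of_nonneg_ae (ae_of_all _ fun ω => Finset.prod_nonneg fun j _ =>
        sub_nonneg.2 measureReal_le_one) (aestronglyMeasurable_of_tendsto_ae atTop hmeas hlim)]
    congr 1
    refine lintegral_congr_ae ?_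
    filter_upwards [hnet.ae_isRegular] with ω hω
    rw [← hnet.measureReal_biInter_freeze hω s, ofReal_measureReal]
  rw [h2]
  exact h1

end HasModel

end Network

namespace Params

variable (p : Params)

lemma measurable_kernExponent {T : ℝ} : Measurable (kernExponent p.lossMeasure T) := by
  have : SFinite p.lossMeasure := by unfold lossMeasure; infer_instance
  have hk : Measurable fun v : ℝ × ℝ => kern T v.1 v.2 :=
    Measurable.ite (measurableSet_le measurable_snd measurable_fst) measurable_const (by fun_prop)
  exact Measurable.lintegral_prod_right' (f := fun v : ℝ × ℝ =>
    ENNReal.ofReal (1 - expNeg (kern T v.1 v.2))) (by fun_prop)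

/-- The weighted density of the minimum path loss, in terms of the Laplace exponent of `kern`: the
void probability in `minLossDensity` and the interference factor `V` are its two parts. -/
lemma condDetectionProb_mul_minLossDensity {z : ℝ} (hz : 0 < z) :
    p.condDetectionProb z * p.minLossDensity z
      = p.lossRate z * (p.noiseFactor z * expNeg (kernExponent p.lossMeasure p.Gam z)) := by
  rw [condDetectionProb, p.V_eq_expNeg hz, p.minLossDensity_eq hz.le,
    kernExponent_eq _ p.Gam_pos hz.le, expNeg_add, noiseFactor]
  ring

lemma tendsto_approxMean (R : ℕ) :
    Tendsto (fun n => p.approxMean R n) atTop (𝓝 (∫⁻ z in Ioc 0 (R : ℝ),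
      ENNReal.ofReal (p.condDetectionProb z * p.minLossDensity z)).toReal) := by
  have hG := p.Gam_pos
  have h := tendsto_sum_cells (μ := p.lossMeasure) hG p.continuous_noiseFactor
    (fun z _ => p.noiseFactor_nonneg z) (fun z hz => p.noiseFactor_le_one hz) R
  have hnn : ∀ z : ℝ, 0 ≤ p.noiseFactor z * expNeg (kernExponent p.lossMeasure p.Gam z) := fun z =>
    mul_nonneg (p.noiseFactor_nonneg z) (expNeg_nonneg _)
  have hle : ∀ z : ℝ, 0 ≤ z →
      p.noiseFactor z * expNeg (kernExponent p.lossMeasure p.Gam z) * (1 / (1 + p.Gam)) ≤ 1 :=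
    fun z hz => mul_le_one₀ (mul_le_one₀ (p.noiseFactor_le_one hz) (expNeg_nonneg _)
      (expNeg_le_one _)) (by positivity) (by rw [div_le_one (by positivity)]; linarith)
  have hfin : ∫⁻ z in Ioc 0 (R : ℝ), ENNReal.ofReal (p.noiseFactor z *
      expNeg (kernExponent p.lossMeasure p.Gam z) * (1 / (1 + p.Gam))) ∂p.lossMeasure ≠ ∞ := by
    refine ne_top_of_le_ne_top (b := p.lossMeasure (Ioc 0 (R : ℝ))) measure_Ioc_lt_top.ne ?_
    rw [← setLIntegral_one]
    exact setLIntegral_mono measurable_const fun z hz => ENNReal.ofReal_le_one.2 (hle z hz.1.le)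
  have hm := p.measurable_kernExponent (T := p.Gam)
  have hc := p.continuous_noiseFactor.measurable
  have hI : ENNReal.ofReal (1 + p.Gam) * ∫⁻ z in Ioc 0 (R : ℝ), ENNReal.ofReal (p.noiseFactor z *
      expNeg (kernExponent p.lossMeasure p.Gam z) * (1 / (1 + p.Gam))) ∂p.lossMeasure
      = ∫⁻ z in Ioc 0 (R : ℝ), ENNReal.ofReal (p.condDetectionProb z * p.minLossDensity z) := by
    rw [← lintegral_const_mul _ (by fun_prop), lossMeasure, restrict_withDensity measurableSet_Ioc,
      Measure.restrict_restrict measurableSet_Ioc,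
      inter_eq_left.2 (Ioc_subset_Ioi_self : Ioc 0 (R : ℝ) ⊆ Ioi 0),
      lintegral_withDensity_eq_lintegral_mul _ (by fun_prop) (by fun_prop), ← lossMeasure]
    refine setLIntegral_congr_fun measurableSet_Ioc fun z hz => ?_
    rw [p.condDetectionProb_mul_minLossDensity hz.1, Pi.mul_apply,
      ← ENNReal.ofReal_mul (by positivity), ← ENNReal.ofReal_mul (p.lossRate_nonneg hz.1.le)]
    congr 1
    field_simp
  rw [← hI, ENNReal.toReal_mul, ENNReal.toReal_ofReal (by positivity)]
  refine (((ENNReal.tendsto_toReal hfin).comp h).const_mul (1 + p.Gam)).congr fun n => ?_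
  rw [approxMean, Function.comp_apply, ENNReal.toReal_sum (fun _ _ => ENNReal.ofReal_ne_top)]
  congr 1
  refine Finset.sum_congr rfl fun m _ => ?_
  rw [lintegral_one_sub_expNeg_kernExcl _ _ (by gcongr; linarith), expNeg_add, ENNReal.toReal_ofReal
    (mul_nonneg (hnn _) (sub_nonneg.2 (expNeg_le_one _)))]
  simp only [kernExponent, cell]
  ring

end Params

namespace Network

variable {Ω : Type*} [MeasurableSpace Ω] {net : Network Ω} {p : Params} {P : Measure Ω}
  [IsProbabilityMeasure P]

/-- The sectors are detected independently, each with probability `sectorDetectionProb`. -/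
theorem HasModel.measureReal_biInter_compl (hnet : net.HasModel p P) (s : Finset (Fin p.K)) :
    P.real (⋂ j ∈ s, (net.sectorDetected p j)ᶜ) = (1 - p.sectorDetectionProb) ^ s.card := by
  set H : ℝ → ℝ≥0∞ := fun z => ENNReal.ofReal (p.condDetectionProb z * p.minLossDensity z)
  let I : ℕ → ℝ≥0∞ := fun R => ∫⁻ z in Ioc 0 (R : ℝ), H z
  have hprod : ∀ (R : ℕ) (s : Finset (Fin p.K)),
      ∫ ω, ∏ j ∈ s, (1 - net.condProb p P R j ω) ∂P = (1 - (I R).toReal) ^ s.card := fun R s =>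
    tendsto_nhds_unique (hnet.tendsto_integral_prod_one_sub_approx R s)
      ((((p.tendsto_approxMean R).const_sub 1).pow s.card).congr fun n =>
        (hnet.integral_prod_one_sub_approx R n s).symm)
  have hHeq : ∀ z ∈ Ioi (0 : ℝ), p.condDetectionProb z * p.minLossDensity z
      = p.lossRate z * (p.noiseFactor z * expNeg (kernExponent p.lossMeasure p.Gam z)) := fun z hz =>
    p.condDetectionProb_mul_minLossDensity hz
  have hI : Tendsto I atTop (𝓝 (∫⁻ z in Ioi (0 : ℝ), H z)) := by
    have hU : ⋃ R : ℕ, Ioc 0 (R : ℝ) = Ioi 0 := by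
      ext z
      simp only [mem_iUnion, mem_Ioc, mem_Ioi, exists_and_left, and_iff_left_iff_imp]
      exact fun _ => exists_nat_ge z
    have h := tendsto_measure_iUnion_atTop (μ := volume.withDensity H)
      (s := fun R : ℕ => Ioc 0 (R : ℝ)) fun m n hmn => Ioc_subset_Ioc_right (by exact_mod_cast hmn)
    rw [hU, withDensity_apply _ measurableSet_Ioi] at h
    exact h.congr fun R => withDensity_apply _ measurableSet_Ioc
  have hItop : ∀ R, I R ≠ ∞ := fun R => by
    refine ne_top_of_le_ne_top (b := p.lossMeasure (Ioc 0 (R : ℝ))) measure_Ioc_lt_top.ne ?_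
    rw [Params.lossMeasure, withDensity_apply _ measurableSet_Ioc,
      Measure.restrict_restrict measurableSet_Ioc,
      inter_eq_left.2 (Ioc_subset_Ioi_self : Ioc 0 (R : ℝ) ⊆ Ioi 0)]
    refine setLIntegral_mono (by fun_prop) fun z hz => ENNReal.ofReal_le_ofReal ?_
    rw [hHeq z hz.1]
    exact mul_le_of_le_one_right (p.lossRate_nonneg hz.1.le)
      (mul_le_one₀ (p.noiseFactor_le_one hz.1.le) (expNeg_nonneg _) (expNeg_le_one _))
  have hI1 : ∀ R, I R ≤ 1 := fun R => by
    have h := hprod R {⟨0, p.K_pos⟩}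
    simp only [Finset.prod_singleton, Finset.card_singleton, pow_one] at h
    have h0 : 0 ≤ ∫ ω, (1 - net.condProb p P R ⟨0, p.K_pos⟩ ω) ∂P :=
      integral_nonneg fun ω => sub_nonneg.2 (condProb_mem_Icc R _ ω).2
    rw [← ENNReal.ofReal_toReal (hItop R)]
    exact ENNReal.ofReal_le_one.2 (by linarith)
  have hne : ∫⁻ z in Ioi (0 : ℝ), H z ≠ ∞ :=
    ne_top_of_le_ne_top ENNReal.one_ne_top (le_of_tendsto' hI hI1)
  have hm := p.measurable_kernExponent (T := p.Gam)
  have hc := p.continuous_noiseFactor.measurable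
  have hS : p.sectorDetectionProb = (∫⁻ z in Ioi (0 : ℝ), H z).toReal := by
    have hmeas : Measurable fun z => p.lossRate z * (p.noiseFactor z *
      expNeg (kernExponent p.lossMeasure p.Gam z)) := by fun_prop
    rw [Params.sectorDetectionProb, integral_eq_lintegral_of_nonneg_ae]
    · refine (ae_restrict_iff' measurableSet_Ioi).2 (ae_of_all _ fun z hz => ?_)
      change 0 ≤ p.condDetectionProb z * p.minLossDensity z
      rw [hHeq z hz]
      exact mul_nonneg (p.lossRate_nonneg (le_of_lt hz))
        (mul_nonneg (p.noiseFactor_nonneg z) (expNeg_nonneg _))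
    · refine hmeas.aestronglyMeasurable.congr ?_
      exact (ae_restrict_iff' measurableSet_Ioi).2 (ae_of_all _ fun z hz => (hHeq z hz).symm)
  rw [hS]
  exact tendsto_nhds_unique (hnet.tendsto_integral_prod_one_sub_condProb s)
    ((((ENNReal.tendsto_toReal hne).comp hI).const_sub 1).pow s.card |>.congr fun R =>
      (hprod R s).symm)

end Network

end MmWave

theorem theorem1 {Ω : Type*} [MeasurableSpace Ω] (P : Measure Ω) [IsProbabilityMeasure P]
    (p : MmWave.Params) (net : MmWave.Network Ω) (hnet : net.HasModel p P) :
    (∀ j : Fin p.K, P.real (net.sectorDetected p j) = p.sectorDetectionProb) ∧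
    P.real (net.cellSearchSuccess p) = 1 - (1 - p.sectorDetectionProb) ^ p.K := by
  have hD : ∀ j, MeasurableSet (net.sectorDetected p j) := fun j =>
    MmWave.Network.measurableSet_sectorDetected hnet.measurable_bs hnet.measurable_los
      hnet.measurable_fading j
  constructor
  · intro j
    have h := hnet.measureReal_biInter_compl {j}
    rw [Finset.set_biInter_singleton, probReal_compl_eq_one_sub (hD j), Finset.card_singleton,
      pow_one] at h
    linarith
  · have h := hnet.measureReal_biInter_compl Finset.univ
    have hset : (⋂ j ∈ (Finset.univ : Finset (Fin p.K)), (net.sectorDetected p j)ᶜ)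
        = (net.cellSearchSuccess p)ᶜ := by
      ext ω
      simp [MmWave.Network.cellSearchSuccess]
    have hS : MeasurableSet (net.cellSearchSuccess p) := by
      have : net.cellSearchSuccess p = ⋃ j, net.sectorDetected p j := by
        ext ω; simp [MmWave.Network.cellSearchSuccess]
      rw [this]
      exact MeasurableSet.iUnion hD
    rw [hset, probReal_compl_eq_one_sub hS, Finset.card_univ, Fintype.card_fin] at h
    linarith
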